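/- Let $N\ge 0$ be an integer and $\theta\in\mathbb R$. Let $V_N$ be a random matrix distributed according to the Haar probability measure on the unitary group $U(N)$, let $e^{i\theta_1},\dots,e^{i\theta_N}$ be its eigenvalues, counted with multiplicity, and put $$Z_N=\det(I_N-e^{-i\theta}V_N),\qquad \log Z_N=\sum_{n=1}^N\log\bigl(1-e^{i(\theta_n-\theta)}\bigr),$$ where each logarithm on the right has imaginary part in $(-\pi/2,\pi/2]$. (On the null event that some $e^{i\theta_n}$ equals $e^{i\theta}$, the undefined terms are given the value $0$.) Let $\beta_{1,0},\beta_{2,1},\dots,\beta_{N,N-1},W_1,\dots,W_N$ be mutually independent real random variables, where $\beta_{1,0}=1$ almost surely, $\beta_{j,j-1}$ has the beta distribution with parameters $j$ and $j-1$ for $2\le j\le N$, and $W_j$ has the density $$\frac{2^{2(j-1)}\,((j-1)!)^2}{\pi\,(2j-2)!}\,\cos^{2(j-1)}(v)\,\mathbf 1_{(-\pi/2,\pi/2)}(v),\qquad 1\le j\le N.$$ Then $$\bigl(\operatorname{Im}\log Z_N,\ |Z_N|\bigr)\overset{\text{law}}{=}\Bigl(\sum_{j=1}^N W_j,\ \prod_{j=1}^N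 \beta_{j,j-1}\,2\cos W_j\Bigr).$$ In particular, $$\operatorname{Re}\log Z_N\overset{\text{law}}{=}\sum_{j=1}^N\log\bigl(\beta_{j,j-1}\,2\cos W_j\bigr),\qquad \operatorname{Im}\log Z_N\overset{\text{law}}{=}\sum_{j=1}^N W_j,$$ and in each of these two sums the summands are independent. -/

import Mathlib

open MeasureTheory ProbabilityTheory

noncomputable section

/-- The value `Z(V, θ) = det (I - e^{-iθ} V)` of the characteristic polynomial of a unitary
matrix `V`. -/
def charPolyZ {N : ℕ} (V : Matrix.unitaryGroup (Fin N) ℂ) (θ : ℝ) : ℂ :=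
  (1 - Complex.exp (-(θ * Complex.I)) • (V : Matrix (Fin N) (Fin N) ℂ)).det

/-- `log Z(V, θ) = ∑ₙ log (1 - e^{i(θₙ - θ)})`, the sum over the eigenvalues `e^{iθₙ}` of `V`
counted with algebraic multiplicity, that is, over the roots of the monic characteristic
polynomial of `V`.  As `1 - e^{i(θₙ - θ)}` has nonnegative real part, the imaginary part of the
principal logarithm `Complex.log` lies in `(-π/2, π/2]` here.  (When `e^{iθ}` is an eigenvalue of
`V`, the logarithm does not exist, and the convention `Complex.log 0 = 0` applies; these `V` form
a null set for Haar measure.) -/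
def logZ {N : ℕ} (V : Matrix.unitaryGroup (Fin N) ℂ) (θ : ℝ) : ℂ :=
  ((V : Matrix (Fin N) (Fin N) ℂ).charpoly.roots.map
    (fun z => Complex.log (1 - Complex.exp (-(θ * Complex.I)) * z))).sum

/-- The law of `β_{j,j-1}` for `j ≥ 1`: the beta distribution with parameters `j` and `j - 1`
when `j ≥ 2`, and the Dirac mass at `1` when `j = 1`. -/
def betaLaw (j : ℕ) : Measure ℝ :=
  if j = 1 then Measure.dirac 1 else betaMeasure (j : ℝ) ((j : ℝ) - 1)

/-- The law of `W_j` for `j ≥ 1`: the measure on the real line with density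
`2^{2(j-1)} ((j-1)!)² / (π (2j-2)!) · cos^{2(j-1)} v` on `(-π/2, π/2)` and `0` elsewhere. -/
def cosLaw (j : ℕ) : Measure ℝ :=
  volume.withDensity fun v => ENNReal.ofReal
    ((Set.Ioo (-(Real.pi / 2)) (Real.pi / 2)).indicator
      (fun v => (2 : ℝ) ^ (2 * (j - 1)) * ((j - 1).factorial : ℝ) ^ 2
        / (Real.pi * ((2 * j - 2).factorial : ℝ)) * Real.cos v ^ (2 * (j - 1))) v)

end

open Matrix
open scoped ENNReal

/-! Multiplication by `exp (-iθ)` is a left translation, so Haar invariance reduces everything to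
`det (1 - V)` and the branch `logDetOneSub`. The proof is an induction on the size, peeling off one
complex reflection at a time.

A unitary `V` with `V₀₀ ≠ 1` is `R · diag(1, V')`, where `R` is the reflection with the same first
column as `V` (`exists_eq_complexReflection_mul_bordered`), and `det (1 - R · diag(1, U)) = (1 -
V₀₀) det (1 - U)` because the perturbation has rank one
(`det_one_sub_complexReflection_mul_bordered`). Multiplying `V` on the right by an independent Haar
`diag(1, U)` does not change its law, and left invariance in `U` absorbs `V'`. Hence the determinant
has the law of a product of two independent factors: `1 - V₀₀` and the determinant of the smaller
size (`lintegral_logDetOneSub_succ`).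

The entry `V₀₀` is distributed as a coordinate of a uniform point of the sphere, whose density on
the disc is proportional to a power of `1 - |α|²`. Polar coordinates about the boundary point `1`
separate this density: `1 - V₀₀` has the law of `β · 2 cos W · exp (iW)`
(`lintegral_one_sub_apply_zero_zero`), so its argument is `W` and its modulus is `β · 2 cos W`.

The product formula determines the imaginary part of the logarithm only modulo `2π`. That the
arguments really add is a continuity argument (`im_logDetOneSub_complexReflection_mul_bordered`):
the reflection is deformed to a diagonal one while the determinant changes only by positive factors.
The branch is continuous where the determinant is nonzero, so the discrepancy, an integer multiple
of `2π`, is constant, and it is zero in the diagonal case. -/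

/-! ### Eigenvalues and the branch of the logarithm of the determinant -/

open scoped Matrix.Norms.L2Operator in
lemma norm_eq_one_of_mem_roots_charpoly {N : ℕ} {A : Matrix (Fin N) (Fin N) ℂ}
    (hA : A ∈ Matrix.unitaryGroup (Fin N) ℂ) {z : ℂ} (hz : z ∈ A.charpoly.roots) : ‖z‖ = 1 := by
  have h : z ∈ spectrum ℂ A := by
    rw [Matrix.mem_spectrum_iff_isRoot_charpoly]
    exact Polynomial.isRoot_of_mem_roots hz
  -- With the L² operator norm the matrices form a C*-algebra, in which unitaries have spectrum on
  -- the unit circle.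
  have := spectrum.subset_circle_of_unitary (𝕜 := ℂ) (E := Matrix (Fin N) (Fin N) ℂ) hA h
  simpa using this

/-- The branch of `log det (1 - A)` given by the sum of the principal logarithms `log (1 - z)`
over the eigenvalues `z` of `A`. -/
noncomputable def Matrix.logDetOneSub {N : ℕ} (A : Matrix (Fin N) (Fin N) ℂ) : ℂ :=
  (A.charpoly.roots.map fun z => Complex.log (1 - z)).sum


lemma Matrix.card_roots_charpoly {N : ℕ} (A : Matrix (Fin N) (Fin N) ℂ) :
    A.charpoly.roots.card = N := by
  rw [← (IsAlgClosed.splits A.charpoly).natDegree_eq_card_roots, A.charpoly_natDegree_eq_dim,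
    Fintype.card_fin]

lemma Matrix.det_smul_one_sub {N : ℕ} (A : Matrix (Fin N) (Fin N) ℂ) (t : ℂ) :
    (t • (1 : Matrix (Fin N) (Fin N) ℂ) - A).det = (A.charpoly.roots.map fun z => t - z).prod := by
  rw [← (IsAlgClosed.splits A.charpoly).eval_eq_prod_roots_of_monic A.charpoly_monic,
    Matrix.eval_charpoly, Matrix.smul_one_eq_diagonal]
  rfl

lemma Matrix.det_one_sub {N : ℕ} (A : Matrix (Fin N) (Fin N) ℂ) :
    (1 - A).det = (A.charpoly.roots.map fun z => 1 - z).prod := by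
  simpa using A.det_smul_one_sub 1

lemma Matrix.roots_charpoly_smul {N : ℕ} (A : Matrix (Fin N) (Fin N) ℂ) {c : ℂ} (hc : c ≠ 0) :
    (c • A).charpoly.roots = A.charpoly.roots.map (c * ·) := by
  have h : (c • A).charpoly
      = ((A.charpoly.roots.map (c * ·)).map fun z => Polynomial.X - Polynomial.C z).prod := by
    refine Polynomial.funext fun t => ?_
    rw [Matrix.eval_charpoly, Polynomial.eval_multiset_prod, Multiset.map_map, Multiset.map_map]
    have h1 : Matrix.scalar (Fin N) t - c • A
        = c • ((t / c) • (1 : Matrix (Fin N) (Fin N) ℂ) - A) := by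
      rw [smul_sub, smul_smul, mul_div_cancel₀ _ hc, Matrix.smul_one_eq_diagonal]
      rfl
    rw [h1, Matrix.det_smul, Matrix.det_smul_one_sub, Fintype.card_fin]
    -- The factor `c ^ N` from the determinant is distributed as one `c` for each of the `N` roots.
    rw [show c ^ N = c ^ A.charpoly.roots.card by rw [A.card_roots_charpoly],
      ← Multiset.prod_replicate, ← Multiset.map_const', ← Multiset.prod_map_mul]
    congr 1
    refine Multiset.map_congr rfl fun z _ => ?_
    simp only [Function.comp, Polynomial.eval_sub, Polynomial.eval_X, Polynomial.eval_C]
    field_simp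
  rw [h, Polynomial.roots_multiset_prod_X_sub_C]

lemma logZ_eq_logDetOneSub {N : ℕ} (V : Matrix.unitaryGroup (Fin N) ℂ) (θ : ℝ) :
    logZ V θ = (Complex.exp (-(θ * Complex.I)) • (V : Matrix (Fin N) (Fin N) ℂ)).logDetOneSub := by
  rw [logZ, Matrix.logDetOneSub, Matrix.roots_charpoly_smul _ (Complex.exp_ne_zero _),
    Multiset.map_map]
  rfl

lemma Matrix.exp_logDetOneSub {N : ℕ} {A : Matrix (Fin N) (Fin N) ℂ} (hA : (1 - A).det ≠ 0) :
    Complex.exp A.logDetOneSub = (1 - A).det := by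
  rw [Matrix.logDetOneSub, Complex.exp_multiset_sum, Multiset.map_map]
  rw [Matrix.det_one_sub] at hA ⊢
  congr 1
  refine Multiset.map_congr rfl fun z hz => ?_
  refine Complex.exp_log fun h0 => hA ?_
  exact Multiset.prod_eq_zero (Multiset.mem_map.2 ⟨z, hz, h0⟩)

/-! ### Block diagonal matrices -/

/-- The block diagonal matrix with blocks `c` and `A`. -/
def Matrix.bordered {n : ℕ} (c : ℂ) (A : Matrix (Fin n) (Fin n) ℂ) :
    Matrix (Fin (n + 1)) (Fin (n + 1)) ℂ :=
  Matrix.of fun i j => Fin.cases (Fin.cases c (fun _ => 0) j)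
    (fun i' => Fin.cases 0 (fun j' => A i' j') j) i

section bordered

variable {n : ℕ} (c : ℂ) (A B : Matrix (Fin n) (Fin n) ℂ)

@[simp] lemma Matrix.bordered_zero_zero : bordered c A 0 0 = c := rfl
@[simp] lemma Matrix.bordered_zero_succ (j : Fin n) : bordered c A 0 j.succ = 0 := rfl
@[simp] lemma Matrix.bordered_succ_zero (i : Fin n) : bordered c A i.succ 0 = 0 := rfl
@[simp] lemma Matrix.bordered_succ_succ (i j : Fin n) : bordered c A i.succ j.succ = A i j := rfl

lemma Matrix.eq_bordered {M : Matrix (Fin (n + 1)) (Fin (n + 1)) ℂ}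
    (hr : ∀ j : Fin n, M 0 j.succ = 0) (hc : ∀ i : Fin n, M i.succ 0 = 0) :
    M = bordered (M 0 0) (Matrix.of fun i j : Fin n => M i.succ j.succ) := by
  ext i j
  refine Fin.cases ?_ (fun i => ?_) i <;> refine Fin.cases ?_ (fun j => ?_) j <;> simp [hr, hc]

lemma Matrix.bordered_one_one : bordered 1 (1 : Matrix (Fin n) (Fin n) ℂ) = 1 := by
  ext i j
  refine Fin.cases ?_ (fun i => ?_) i <;> refine Fin.cases ?_ (fun j => ?_) j <;>
    simp [Matrix.one_apply, Fin.succ_ne_zero, (Fin.succ_ne_zero _).symm]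

lemma Matrix.bordered_mul (d : ℂ) : bordered c A * bordered d B = bordered (c * d) (A * B) := by
  ext i j
  refine Fin.cases ?_ (fun i => ?_) i <;> refine Fin.cases ?_ (fun j => ?_) j <;>
    simp [Matrix.mul_apply, Fin.sum_univ_succ]

lemma Matrix.star_bordered : star (bordered c A) = bordered (star c) (star A) := by
  ext i j
  refine Fin.cases ?_ (fun i => ?_) i <;> refine Fin.cases ?_ (fun j => ?_) j <;>
    simp [Matrix.star_apply]

lemma Matrix.bordered_injective (h : bordered c A = bordered c B) : A = B := by
  ext i j
  simpa using congrFun (congrFun h i.succ) j.succ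

lemma Matrix.bordered_one_mem_unitaryGroup_iff :
    bordered 1 A ∈ Matrix.unitaryGroup (Fin (n + 1)) ℂ ↔ A ∈ Matrix.unitaryGroup (Fin n) ℂ := by
  rw [Matrix.mem_unitaryGroup_iff, Matrix.mem_unitaryGroup_iff, Matrix.star_bordered,
    Matrix.bordered_mul, star_one, one_mul, ← Matrix.bordered_one_one]
  exact ⟨Matrix.bordered_injective _ _ _, fun h => by rw [h]⟩

lemma Matrix.charpoly_bordered :
    (bordered c A).charpoly = (Polynomial.X - Polynomial.C c) * A.charpoly := by
  rw [Matrix.charpoly, Matrix.det_succ_row_zero, Fin.sum_univ_succ, Finset.sum_eq_zero]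
  · have h : ((bordered c A).charmatrix.submatrix Fin.succ (Fin.succAbove 0)) = A.charmatrix := by
      ext i j : 2
      simp [Matrix.charmatrix_apply, Matrix.diagonal_apply]
    rw [h]
    simp [Matrix.charpoly]
  · intro j _
    simp [(Fin.succ_ne_zero _).symm]

lemma Matrix.logDetOneSub_bordered :
    (bordered c A).logDetOneSub = Complex.log (1 - c) + A.logDetOneSub := by
  rw [Matrix.logDetOneSub, Matrix.charpoly_bordered, Polynomial.roots_mul, Polynomial.roots_X_sub_C]
  · simp [Matrix.logDetOneSub]
  · exact mul_ne_zero (Polynomial.X_sub_C_ne_zero c) A.charpoly_monic.ne_zero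

end bordered

/-! ### Complex reflections and the product formula for the determinant -/

/-- The rank one perturbation `1 - κ v v*` of the identity, a complex reflection if
`2 Re κ = |κ|² |v|²`. -/
noncomputable def Matrix.complexReflection {N : ℕ} (κ : ℂ) (v : Fin N → ℂ) :
    Matrix (Fin N) (Fin N) ℂ :=
  1 - κ • Matrix.vecMulVec v (star v)

/-- With `P = v v*` self-adjoint and `P² = |v|² P`, the product `(1 - κP)(1 - κ̄P)` is `1 - (κ + κ̄
- |κ|² |v|²) P`, and the hypothesis kills the bracket. -/
lemma Matrix.complexReflection_mem_unitaryGroup {N : ℕ} {κ : ℂ} {v : Fin N → ℂ}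
    (h : 2 * κ.re = ‖κ‖ ^ 2 * ∑ i, ‖v i‖ ^ 2) :
    complexReflection κ v ∈ Matrix.unitaryGroup (Fin N) ℂ := by
  have hv : star v ⬝ᵥ v = ((∑ i, ‖v i‖ ^ 2 : ℝ) : ℂ) := by
    simp [dotProduct, Complex.conj_mul']
  have hs : star (vecMulVec v (star v)) = vecMulVec v (star v) := by
    ext i j
    simp [Matrix.star_apply, vecMulVec_apply, mul_comm]
  have hκ : κ + star κ = κ * star κ * ((∑ i, ‖v i‖ ^ 2 : ℝ) : ℂ) := by
    have h1 : κ * star κ = ((‖κ‖ ^ 2 : ℝ) : ℂ) := by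
      rw [Complex.star_def, Complex.mul_conj']; push_cast; rfl
    rw [h1, ← Complex.ofReal_mul, ← h, Complex.star_def, Complex.add_conj]
  rw [Matrix.mem_unitaryGroup_iff, complexReflection, star_sub, star_one, star_smul, hs, sub_mul,
    one_mul, mul_sub, mul_one, smul_mul_smul_comm, vecMulVec_mul_vecMulVec, hv]
  have : vecMulVec v (((∑ i, ‖v i‖ ^ 2 : ℝ) : ℂ) • star v)
      = ((∑ i, ‖v i‖ ^ 2 : ℝ) : ℂ) • vecMulVec v (star v) := by
    ext i j
    simp [vecMulVec_apply]
    ring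
  rw [this, smul_smul, ← hκ, add_smul]
  abel

/-- The first column of `1 - bordered 1 U` is zero, so adding the rank one matrix `κ v r` amounts to
filling that column with `κ v` and then applying the unipotent matrix `T` whose first row is `r`.
Expansion of `L` along its first row `(κ, 0, …, 0)` gives the result; unitarity plays no role. -/
lemma Matrix.det_one_sub_complexReflection_mul_bordered {n : ℕ} (κ : ℂ) {v : Fin (n + 1) → ℂ}
    (hv : v 0 = 1) (U : Matrix (Fin n) (Fin n) ℂ) :
    (1 - complexReflection κ v * bordered 1 U).det = κ * (1 - U).det := by
  set r : Fin (n + 1) → ℂ := star v ᵥ* bordered 1 U with hr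
  have hr0 : r 0 = 1 := by simp [hr, Matrix.vecMul, dotProduct, Fin.sum_univ_succ, hv]
  -- `L` has the first column `κ v` and the other columns of `1 - bordered 1 U`
  let L : Matrix (Fin (n + 1)) (Fin (n + 1)) ℂ :=
    Matrix.of fun i j => Fin.cases (κ * v i) (fun j' => (1 - bordered 1 U) i j'.succ) j
  let T : Matrix (Fin (n + 1)) (Fin (n + 1)) ℂ :=
    Matrix.of fun i j => Fin.cases (r j) (fun i' => (1 : Matrix _ _ ℂ) i'.succ j) i
  have hLT : 1 - complexReflection κ v * bordered 1 U = L * T := by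
    have h1 : complexReflection κ v * bordered 1 U = bordered 1 U - κ • vecMulVec v r := by
      rw [complexReflection, sub_mul, one_mul, smul_mul_assoc, vecMulVec_mul]
    rw [h1]
    ext i j
    rw [Matrix.mul_apply, Fin.sum_univ_succ]
    refine Fin.cases ?_ (fun j => ?_) j
    · have : (bordered 1 U) i 0 = (1 : Matrix (Fin (n + 1)) (Fin (n + 1)) ℂ) i 0 := by
        refine Fin.cases ?_ (fun i => ?_) i <;> simp
      simp [L, T, this, vecMulVec_apply, hr0, Matrix.one_apply]
    · simp [L, T, vecMulVec_apply, Matrix.one_apply]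
      ring
  have hT : T.det = 1 := by
    rw [Matrix.det_succ_column_zero, Fin.sum_univ_succ, Finset.sum_eq_zero]
    · have : T.submatrix (Fin.succAbove 0) Fin.succ = 1 := by
        ext i j
        simp [T, Matrix.one_apply]
      rw [this]
      simp [T, hr0]
    · intro i _
      simp [T, Matrix.one_apply]
  have hL : L.det = κ * (1 - U).det := by
    rw [Matrix.det_succ_row_zero, Fin.sum_univ_succ, Finset.sum_eq_zero]
    · have : L.submatrix Fin.succ (Fin.succAbove 0) = 1 - U := by
        ext i j
        simp [L, Matrix.one_apply]
      rw [this]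
      simp [L, hv]
    · intro i _
      simp [L, Matrix.one_apply, (Fin.succ_ne_zero _).symm]
  rw [hLT, Matrix.det_mul, hT, hL, mul_one]

/-! ### Continuity of the branch on the unitary group -/

instance Matrix.unitaryGroup.instCompactSpace {N : ℕ} :
    CompactSpace (Matrix.unitaryGroup (Fin N) ℂ) := by
  refine isCompact_iff_compactSpace.1 ?_
  have hcl : IsClosed (Matrix.unitaryGroup (Fin N) ℂ : Set (Matrix (Fin N) (Fin N) ℂ)) := by
    have : (Matrix.unitaryGroup (Fin N) ℂ : Set (Matrix (Fin N) (Fin N) ℂ))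
        = {A | A * star A = 1} := by
      ext A
      exact Matrix.mem_unitaryGroup_iff
    rw [this]
    exact isClosed_eq (by fun_prop) continuous_const
  refine (isCompact_univ_pi fun _ : Fin N => isCompact_univ_pi fun _ : Fin N =>
    isCompact_closedBall (0 : ℂ) 1).of_isClosed_subset hcl fun A hA i _ j _ => ?_
  simpa using entry_norm_bound_of_unitary hA i j

lemma Matrix.roots_charpoly_eq_map {N : ℕ} {A : Matrix (Fin N) (Fin N) ℂ} {z : Fin N → ℂ}
    (h : ∀ t : ℂ, (t • (1 : Matrix (Fin N) (Fin N) ℂ) - A).det = ∏ i, (t - z i)) :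
    A.charpoly.roots = Finset.univ.val.map z := by
  have : A.charpoly
      = ((Finset.univ.val.map z).map fun w => Polynomial.X - Polynomial.C w).prod := by
    refine Polynomial.funext fun t => ?_
    rw [Matrix.eval_charpoly, Polynomial.eval_multiset_prod, Multiset.map_map, Multiset.map_map]
    rw [Matrix.scalar_apply, ← Matrix.smul_one_eq_diagonal, h t]
    simp [Finset.prod]
  rw [this, Polynomial.roots_multiset_prod_X_sub_C]

lemma Matrix.exists_det_smul_one_sub_eq_prod {N : ℕ} (A : Matrix (Fin N) (Fin N) ℂ) :
    ∃ z : Fin N → ℂ, A.charpoly.roots = Finset.univ.val.map z ∧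
      ∀ t : ℂ, (t • (1 : Matrix (Fin N) (Fin N) ℂ) - A).det = ∏ i, (t - z i) := by
  obtain ⟨l, hl⟩ := Quot.exists_rep A.charpoly.roots
  have hlen : l.length = N := by
    rw [← A.card_roots_charpoly, ← hl]; rfl
  subst hlen
  have hz : A.charpoly.roots = Finset.univ.val.map l.get := by
    rw [← hl]
    simp
  refine ⟨l.get, hz, fun t => ?_⟩
  rw [Matrix.det_smul_one_sub, hz, Multiset.map_map]
  rfl

lemma Complex.one_sub_mem_slitPlane {z : ℂ} (hz : ‖z‖ ≤ 1) (h1 : 1 - z ≠ 0) :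
    1 - z ∈ Complex.slitPlane := by
  rw [Complex.mem_slitPlane_iff]
  by_contra! h
  have h2 : z.re ≤ 1 := (Complex.re_le_norm z).trans hz
  have h3 : z.re = 1 := le_antisymm h2 (by simpa using h.1)
  have h4 : z.im = 0 := by simpa using h.2
  exact h1 (Complex.ext (by simp [h3]) (by simp [h4]))

/-- The eigenvalues of a unitary matrix, taken as an unordered tuple, depend continuously on it, so
that the branch `logDetOneSub` of `log det (1 - V)` is continuous where the determinant does not
vanish. -/
theorem Matrix.continuousOn_logDetOneSub {N : ℕ} :
    ContinuousOn (fun V : Matrix.unitaryGroup (Fin N) ℂ =>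
      (V : Matrix (Fin N) (Fin N) ℂ).logDetOneSub)
      {V | (1 - (V : Matrix (Fin N) (Fin N) ℂ)).det ≠ 0} := by
  -- `K` consists of the unitary matrices paired with an enumeration of their eigenvalues. It is
  -- closed and bounded, hence compact, and on it each eigenvalue is a coordinate, so no continuous
  -- choice of eigenvalues is needed.
  let K : Set (Matrix.unitaryGroup (Fin N) ℂ × (Fin N → ℂ)) :=
    {p | (∀ i, ‖p.2 i‖ ≤ 1) ∧
      ∀ t : ℂ, (t • (1 : Matrix (Fin N) (Fin N) ℂ) - p.1).det = ∏ i, (t - p.2 i)}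
  have hKcl : IsClosed K := by
    have hKeq : K = (⋂ i, {p | ‖p.2 i‖ ≤ 1}) ∩
        ⋂ t : ℂ, {p | (t • (1 : Matrix (Fin N) (Fin N) ℂ) - p.1).det = ∏ i, (t - p.2 i)} := by
      ext p
      simp [K]
    rw [hKeq]
    exact IsClosed.inter
      (isClosed_iInter fun i => isClosed_le (by fun_prop) continuous_const)
      (isClosed_iInter fun t => isClosed_eq (by fun_prop) (by fun_prop))
  have hK : IsCompact K := by
    refine (isCompact_univ.prod (isCompact_univ_pi fun _ : Fin N =>
      isCompact_closedBall (0 : ℂ) 1)).of_isClosed_subset hKcl fun p hp => ⟨trivial, fun i _ => ?_⟩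
    simpa using hp.1 i
  have : CompactSpace K := isCompact_iff_compactSpace.1 hK
  let π : K → Matrix.unitaryGroup (Fin N) ℂ := fun p => p.1.1
  have hπc : Continuous π := by fun_prop
  have hπs : Function.Surjective π := by
    intro V
    obtain ⟨z, hz, h⟩ := (V : Matrix (Fin N) (Fin N) ℂ).exists_det_smul_one_sub_eq_prod
    refine ⟨⟨(V, z), fun i => (norm_eq_one_of_mem_roots_charpoly V.2 ?_).le, h⟩, rfl⟩
    rw [hz]
    exact Multiset.mem_map_of_mem _ (Finset.mem_univ i)
  -- A continuous surjection from a compact space to a Hausdorff space is a quotient map, so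
  -- continuity may be checked after composition with `π`.
  have hq : Topology.IsQuotientMap π := hπc.isClosedMap.isQuotientMap hπc hπs
  have ho : IsOpen {V : Matrix.unitaryGroup (Fin N) ℂ |
      (1 - (V : Matrix (Fin N) (Fin N) ℂ)).det ≠ 0} :=
    isOpen_ne_fun (by fun_prop) continuous_const
  rw [hq.continuousOn_isOpen_iff ho]
  have hroots (p : K) := Matrix.roots_charpoly_eq_map p.2.2
  have heq : (fun V : Matrix.unitaryGroup (Fin N) ℂ =>
      (V : Matrix (Fin N) (Fin N) ℂ).logDetOneSub) ∘ π
      = fun p : K => ∑ i, Complex.log (1 - p.1.2 i) := by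
    funext p
    simp only [Function.comp, Matrix.logDetOneSub, π]
    rw [hroots p, Multiset.map_map]
    rfl
  rw [heq]
  refine continuousOn_finsetSum _ fun i _ => ContinuousOn.clog (by fun_prop) fun p hp => ?_
  refine Complex.one_sub_mem_slitPlane (p.2.1 i) fun h0 => hp ?_
  change (1 - (p.1.1 : Matrix (Fin N) (Fin N) ℂ)).det = 0
  have := p.2.2 1
  rw [one_smul] at this
  rw [this]
  exact Finset.prod_eq_zero (Finset.mem_univ i) h0

lemma Continuous.logDetOneSub {X : Type*} [TopologicalSpace X] {N : ℕ}
    {f : X → Matrix (Fin N) (Fin N) ℂ} (hf : Continuous f)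
    (hu : ∀ x, f x ∈ Matrix.unitaryGroup (Fin N) ℂ) (hd : ∀ x, (1 - f x).det ≠ 0) :
    Continuous fun x => (f x).logDetOneSub := by
  let g : X → Matrix.unitaryGroup (Fin N) ℂ := fun x => ⟨f x, hu x⟩
  have hg : Continuous g := hf.subtype_mk hu
  have hd' (x : X) : g x ∈ {V : Matrix.unitaryGroup (Fin N) ℂ |
      (1 - (V : Matrix (Fin N) (Fin N) ℂ)).det ≠ 0} := by
    simpa [g] using hd x
  have h := ContinuousOn.comp_continuous Matrix.continuousOn_logDetOneSub hg hd'
  exact h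

/-- The image of the connected line lies in a countable, hence totally disconnected, set of reals.
-/
lemma Continuous.eq_of_forall_exists_two_pi_mul_int {f : ℝ → ℝ} (hf : Continuous f)
    (h : ∀ s, ∃ n : ℤ, f s = n * (2 * Real.pi)) (a b : ℝ) : f a = f b := by
  have hT : (Set.range fun n : ℤ => (n : ℝ) * (2 * Real.pi)).Countable := Set.countable_range _
  have hsub := (isPreconnected_univ.image f hf.continuousOn)
  have : (f '' Set.univ).Subsingleton := by
    refine Set.Countable.isTotallyDisconnected hT _ ?_ hsub
    rintro _ ⟨s, -, rfl⟩
    obtain ⟨n, hn⟩ := h s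
    exact ⟨n, hn.symm⟩
  exact this ⟨a, trivial, rfl⟩ ⟨b, trivial, rfl⟩

/-! ### Additivity of the argument by deformation -/

/-- The endpoint of the deformation: the reflection acts on the first coordinate alone, so the
spectrum splits and the logarithms add by definition. -/
lemma Matrix.complexReflection_cons_zero_mul_bordered {n : ℕ} (κ : ℂ)
    (U : Matrix (Fin n) (Fin n) ℂ) :
    complexReflection κ (Fin.cons 1 0) * bordered 1 U = bordered (1 - κ) U := by
  have : complexReflection κ (Fin.cons 1 0 : Fin (n + 1) → ℂ) = bordered (1 - κ) 1 := by
    ext i j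
    refine Fin.cases ?_ (fun i => ?_) i <;> refine Fin.cases ?_ (fun j => ?_) j <;>
      simp [complexReflection, vecMulVec_apply, Matrix.one_apply, (Fin.succ_ne_zero _).symm]
  rw [this, Matrix.bordered_mul, mul_one, one_mul]

/-- The branch of `log det` is additive along the decomposition of a unitary matrix into a complex
reflection and a unitary matrix of smaller size. -/
theorem Matrix.im_logDetOneSub_complexReflection_mul_bordered {n : ℕ} {κ : ℂ} {ζ : Fin n → ℂ}
    (hκ : κ ≠ 0) (h : 2 * κ.re = ‖κ‖ ^ 2 * (1 + ∑ i, ‖ζ i‖ ^ 2))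
    {U : Matrix (Fin n) (Fin n) ℂ} (hU : U ∈ Matrix.unitaryGroup (Fin n) ℂ)
    (hdet : (1 - U).det ≠ 0) :
    (complexReflection κ (Fin.cons 1 ζ) * bordered 1 U).logDetOneSub.im
      = κ.arg + U.logDetOneSub.im := by
  set S : ℝ := ∑ i, ‖ζ i‖ ^ 2 with hS
  have hS0 : 0 ≤ S := by positivity
  -- Shrinking `ζ` to `s ζ` breaks the reflection condition; it is restored by scaling `κ` by the
  -- `r` with `r (1 + s² S) = 1 + S`. As `r > 0`, the argument of `r κ` is that of `κ`, and `r 1 =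
  -- 1`.
  let r : ℝ → ℝ := fun s => (1 + S) / (1 + s ^ 2 * S)
  have hr0 (s : ℝ) : 0 < 1 + s ^ 2 * S := by positivity
  have hr (s : ℝ) : 0 < r s := div_pos (by positivity) (hr0 s)
  let v : ℝ → Fin (n + 1) → ℂ := fun s => Fin.cons 1 fun i => (s : ℂ) * ζ i
  let M : ℝ → Matrix (Fin (n + 1)) (Fin (n + 1)) ℂ := fun s =>
    complexReflection (r s * κ) (v s) * bordered 1 U
  have hMu (s : ℝ) : M s ∈ Matrix.unitaryGroup (Fin (n + 1)) ℂ := by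
    refine mul_mem (complexReflection_mem_unitaryGroup ?_)
      ((bordered_one_mem_unitaryGroup_iff U).2 hU)
    have hv : ∑ i, ‖v s i‖ ^ 2 = 1 + s ^ 2 * S := by
      rw [Fin.sum_univ_succ]
      simp [v, mul_pow, ← Finset.mul_sum, hS]
    have h2 : r s * (1 + s ^ 2 * S) = 1 + S := div_mul_cancel₀ _ (hr0 s).ne'
    rw [hv, Complex.re_ofReal_mul, norm_mul, Complex.norm_real, Real.norm_of_nonneg (hr s).le]
    calc 2 * (r s * κ.re) = r s * (‖κ‖ ^ 2 * (1 + S)) := by rw [← h]; ring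
      _ = _ := by rw [← h2]; ring
  have hMd (s : ℝ) : (1 - M s).det = r s * κ * (1 - U).det :=
    det_one_sub_complexReflection_mul_bordered _ (by simp [v]) U
  have hMd0 (s : ℝ) : (1 - M s).det ≠ 0 := by
    rw [hMd]
    exact mul_ne_zero (mul_ne_zero (by exact_mod_cast (hr s).ne') hκ) hdet
  have hrc : Continuous r := by
    refine Continuous.div (by fun_prop) (by fun_prop) fun s => (hr0 s).ne'
  have hvc : Continuous v := by
    refine continuous_pi fun i => ?_
    refine Fin.cases ?_ (fun i => ?_) i
    · simpa [v] using continuous_const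
    · simp only [v, Fin.cons_succ]
      fun_prop
  have hMc : Continuous M := by
    simp only [M, complexReflection]
    fun_prop
  let f : ℝ → ℝ := fun s => (M s).logDetOneSub.im - κ.arg - U.logDetOneSub.im
  have hf : Continuous f := by
    have : Continuous fun s => (M s).logDetOneSub := hMc.logDetOneSub hMu hMd0
    exact ((Complex.continuous_im.comp this).sub continuous_const).sub continuous_const
  -- Both candidates for the logarithm exponentiate to `r κ det (1 - U)`.
  have hint (s : ℝ) : ∃ m : ℤ, f s = m * (2 * Real.pi) := by
    have h1 := exp_logDetOneSub (hMd0 s)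
    rw [hMd, ← exp_logDetOneSub hdet] at h1
    have h2 : Complex.exp (M s).logDetOneSub
        = Complex.exp (Complex.log (r s * κ) + U.logDetOneSub) := by
      rw [Complex.exp_add, Complex.exp_log, h1]
      exact mul_ne_zero (by exact_mod_cast (hr s).ne') hκ
    obtain ⟨m, hm⟩ := Complex.exp_eq_exp_iff_exists_int.1 h2
    refine ⟨m, ?_⟩
    have h3 := congrArg Complex.im hm
    have h4 : ((m : ℂ) * (2 * Real.pi * Complex.I)).im = m * (2 * Real.pi) := by simp
    rw [Complex.add_im, Complex.add_im, h4, Complex.log_im, Complex.arg_real_mul _ (hr s)] at h3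
    simp only [f, h3]
    ring
  have h01 := hf.eq_of_forall_exists_two_pi_mul_int hint 1 0
  have hM1 : M 1 = complexReflection κ (Fin.cons 1 ζ) * bordered 1 U := by
    have : r 1 = 1 := by
      simp only [r, one_pow, one_mul]
      exact div_self (by positivity)
    simp [M, v, this]
  have hM0 : M 0 = bordered (1 - r 0 * κ) U := by
    rw [← complexReflection_cons_zero_mul_bordered]
    simp only [M, v, Complex.ofReal_zero, zero_mul]
    rfl
  simp only [f] at h01
  rw [hM1, hM0, logDetOneSub_bordered, Complex.add_im, sub_sub_cancel, Complex.log_im,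
    Complex.arg_real_mul _ (hr 0)] at h01
  linarith

/-! ### Factorization of unitary matrices through reflections -/

/-- Every unit vector `x` with `x₀ ≠ 1` is the first column of a complex reflection. -/
lemma Matrix.exists_complexReflection_apply_zero {n : ℕ} {x : Fin (n + 1) → ℂ}
    (hx : ∑ i, ‖x i‖ ^ 2 = 1) (h : x 0 ≠ 1) :
    ∃ ζ : Fin n → ℂ, 2 * (1 - x 0).re = ‖1 - x 0‖ ^ 2 * (1 + ∑ i, ‖ζ i‖ ^ 2) ∧
      (complexReflection (1 - x 0) (Fin.cons 1 ζ : Fin (n + 1) → ℂ) ∈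
        Matrix.unitaryGroup (Fin (n + 1)) ℂ) ∧
      ∀ i, complexReflection (1 - x 0) (Fin.cons 1 ζ : Fin (n + 1) → ℂ) i 0 = x i := by
  have hκ : 1 - x 0 ≠ 0 := sub_ne_zero.2 h.symm
  set κ := 1 - x 0 with hκdef
  -- The lower entries of the first column of `1 - κ v v*` are `-κ ζᵢ`, which forces this choice.
  -- The reflection condition is then `|1 - x₀|² + (1 - |x₀|²) = 2 Re (1 - x₀)`.
  let ζ : Fin n → ℂ := fun i => -x i.succ / κ
  have hcond : 2 * κ.re = ‖κ‖ ^ 2 * (1 + ∑ i, ‖ζ i‖ ^ 2) := by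
    have h1 : ‖κ‖ ^ 2 * ∑ i, ‖ζ i‖ ^ 2 = ∑ i : Fin n, ‖x i.succ‖ ^ 2 := by
      rw [Finset.mul_sum]
      refine Finset.sum_congr rfl fun i _ => ?_
      simp only [ζ, norm_div, norm_neg]
      have := norm_ne_zero_iff.2 hκ
      field_simp
    rw [mul_add, h1, mul_one, Complex.sq_norm, Complex.normSq_apply]
    rw [Fin.sum_univ_succ, Complex.sq_norm, Complex.normSq_apply] at hx
    simp only [hκdef, Complex.sub_re, Complex.one_re, Complex.sub_im, Complex.one_im]
    linarith
  refine ⟨ζ, hcond, complexReflection_mem_unitaryGroup ?_, fun i => ?_⟩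
  · rw [hcond, Fin.sum_univ_succ]
    simp
  · refine Fin.cases ?_ (fun i => ?_) i
    · simp [complexReflection, vecMulVec_apply, hκdef]
    · simp only [complexReflection, sub_apply, ne_eq, Fin.succ_ne_zero, not_false_eq_true,
        one_apply_ne, smul_apply, vecMulVec_apply, Fin.cons_succ, Pi.star_apply, Fin.cons_zero,
        star_one, mul_one, smul_eq_mul, zero_sub, ζ]
      field_simp

lemma Matrix.sum_norm_sq_col_of_mem_unitaryGroup {N : ℕ} {V : Matrix (Fin N) (Fin N) ℂ}
    (hV : V ∈ Matrix.unitaryGroup (Fin N) ℂ) (j : Fin N) : ∑ i, ‖V i j‖ ^ 2 = 1 := by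
  have h1 := congrFun (congrFun (Matrix.mem_unitaryGroup_iff'.1 hV) j) j
  rw [Matrix.mul_apply] at h1
  simp only [Matrix.star_apply, Complex.star_def, Complex.conj_mul', Matrix.one_apply_eq] at h1
  exact_mod_cast h1

/-- Every unit vector is the first column of a unitary matrix. -/
lemma Matrix.exists_unitaryGroup_apply_zero {n : ℕ} {x : Fin (n + 1) → ℂ}
    (hx : ∑ i, ‖x i‖ ^ 2 = 1) :
    ∃ R : Matrix.unitaryGroup (Fin (n + 1)) ℂ, ∀ i, (R : Matrix (Fin (n + 1)) (Fin (n + 1)) ℂ) i 0 = x i := by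
  by_cases h : x 0 = 1
  · refine ⟨1, fun i => ?_⟩
    have h0 : ∑ i : Fin n, ‖x i.succ‖ ^ 2 = 0 := by
      rw [Fin.sum_univ_succ, h] at hx
      simpa using hx
    rw [Finset.sum_eq_zero_iff_of_nonneg fun _ _ => by positivity] at h0
    refine Fin.cases ?_ (fun i => ?_) i
    · simp [h]
    · have := h0 i (Finset.mem_univ i)
      simp_all
  · obtain ⟨ζ, -, hR, hcol⟩ := exists_complexReflection_apply_zero hx h
    exact ⟨⟨_, hR⟩, hcol⟩

/-- Every unitary matrix `V` with `V₀₀ ≠ 1` is the product of a complex reflection and a unitary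
matrix of smaller size. -/
theorem Matrix.exists_eq_complexReflection_mul_bordered {n : ℕ}
    {V : Matrix (Fin (n + 1)) (Fin (n + 1)) ℂ} (hV : V ∈ Matrix.unitaryGroup (Fin (n + 1)) ℂ)
    (h : V 0 0 ≠ 1) :
    ∃ (ζ : Fin n → ℂ) (U : Matrix.unitaryGroup (Fin n) ℂ),
      2 * (1 - V 0 0).re = ‖1 - V 0 0‖ ^ 2 * (1 + ∑ i, ‖ζ i‖ ^ 2) ∧
      V = complexReflection (1 - V 0 0) (Fin.cons 1 ζ) * bordered 1 (U : Matrix _ _ ℂ) := by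
  obtain ⟨ζ, hcond, hRu, hRcol⟩ :=
    exists_complexReflection_apply_zero (sum_norm_sq_col_of_mem_unitaryGroup hV 0) h
  set R := complexReflection (1 - V 0 0) (Fin.cons 1 ζ : Fin (n + 1) → ℂ) with hR
  have hRR := Matrix.mem_unitaryGroup_iff.1 hRu
  have hRR' := Matrix.mem_unitaryGroup_iff'.1 hRu
  -- `R` and `V` share their first column, so `M` fixes the first basis vector. Its first row has
  -- norm one and already contains a `1`, so the rest of that row vanishes and `M` is block
  -- diagonal.
  set M := star R * V with hM
  have hMu : M ∈ Matrix.unitaryGroup (Fin (n + 1)) ℂ :=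
    mul_mem (Unitary.star_mem hRu) hV
  have hMcol (i : Fin (n + 1)) : M i 0 = (1 : Matrix (Fin (n + 1)) (Fin (n + 1)) ℂ) i 0 := by
    rw [← hRR', hM, Matrix.mul_apply, Matrix.mul_apply]
    simp only [hRcol]
  have hMrow : ∀ j : Fin n, M 0 j.succ = 0 := by
    have h1 := congrFun (congrFun (Matrix.mem_unitaryGroup_iff.1 hMu) 0) 0
    rw [Matrix.mul_apply, Fin.sum_univ_succ] at h1
    simp only [Matrix.star_apply, Complex.star_def, Complex.mul_conj', Matrix.one_apply_eq,
      hMcol] at h1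
    have h2 : ∑ j : Fin n, ‖M 0 j.succ‖ ^ 2 = 0 := by
      have : ∑ j : Fin n, (‖M 0 j.succ‖ : ℂ) ^ 2 = 0 := by simpa using h1
      exact_mod_cast this
    intro j
    rw [Finset.sum_eq_zero_iff_of_nonneg fun _ _ => by positivity] at h2
    simpa using h2 j (Finset.mem_univ j)
  have hMb := Matrix.eq_bordered hMrow fun i => by simp [hMcol]
  rw [hMcol, Matrix.one_apply_eq] at hMb
  refine ⟨ζ, ⟨_, (bordered_one_mem_unitaryGroup_iff _).1 (hMb ▸ hMu)⟩, hcond, ?_⟩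
  rw [← hR, ← hMb, hM, ← mul_assoc, hRR, one_mul]

/-! ### Unitary invariance and the law of the first entry -/

/-- The squared Euclidean norm of a complex vector. -/
noncomputable def sumNormSq {N : ℕ} (y : Fin N → ℂ) : ℝ := ∑ i, ‖y i‖ ^ 2

lemma sumNormSq_nonneg {N : ℕ} (y : Fin N → ℂ) : 0 ≤ sumNormSq y := by
  unfold sumNormSq; positivity

@[fun_prop]
lemma continuous_sumNormSq {N : ℕ} : Continuous (sumNormSq (N := N)) := by
  unfold sumNormSq; fun_prop

@[fun_prop]
lemma measurable_sumNormSq {N : ℕ} : Measurable (sumNormSq (N := N)) :=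
  continuous_sumNormSq.measurable

lemma sumNormSq_pos {N : ℕ} {y : Fin N → ℂ} (hy : y ≠ 0) : 0 < sumNormSq y := by
  obtain ⟨i, hi⟩ := Function.ne_iff.1 hy
  exact Finset.sum_pos' (fun _ _ => by positivity)
    ⟨i, Finset.mem_univ i, by have : 0 < ‖y i‖ := norm_pos_iff.2 hi; positivity⟩

lemma sumNormSq_smul {N : ℕ} (c : ℝ) (y : Fin N → ℂ) : sumNormSq (c • y) = c ^ 2 * sumNormSq y := by
  simp [sumNormSq, mul_pow, Finset.mul_sum]

lemma sumNormSq_cons {N : ℕ} (z : ℂ) (y : Fin N → ℂ) :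
    sumNormSq (Fin.cons z y : Fin (N + 1) → ℂ) = ‖z‖ ^ 2 + sumNormSq y := by
  simp [sumNormSq, Fin.sum_univ_succ]

lemma sumNormSq_eq_dotProduct {N : ℕ} (y : Fin N → ℂ) : (sumNormSq y : ℂ) = star y ⬝ᵥ y := by
  simp [sumNormSq, dotProduct, Complex.conj_mul']

lemma sumNormSq_mulVec {N : ℕ} {V : Matrix (Fin N) (Fin N) ℂ}
    (hV : V ∈ Matrix.unitaryGroup (Fin N) ℂ) (y : Fin N → ℂ) :
    sumNormSq (V *ᵥ y) = sumNormSq y := by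
  have : (sumNormSq (V *ᵥ y) : ℂ) = sumNormSq y := by
    have h := Matrix.mem_unitaryGroup_iff'.1 hV
    rw [star_eq_conjTranspose] at h
    rw [sumNormSq_eq_dotProduct, sumNormSq_eq_dotProduct, star_mulVec, dotProduct_mulVec,
      vecMul_vecMul, h, vecMul_one]
  exact_mod_cast this

lemma isOpen_sumNormSq_lt {N : ℕ} (t : ℝ) : IsOpen {y : Fin N → ℂ | sumNormSq y < t} :=
  isOpen_lt continuous_sumNormSq continuous_const

lemma volume_sumNormSq_lt_one_ne_zero {N : ℕ} :
    volume {y : Fin N → ℂ | sumNormSq y < 1} ≠ 0 :=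
  ((isOpen_sumNormSq_lt 1).measure_pos volume ⟨0, by simp [sumNormSq]⟩).ne'

lemma volume_sumNormSq_lt_one_ne_top {N : ℕ} :
    volume {y : Fin N → ℂ | sumNormSq y < 1} ≠ ∞ := by
  refine ((measure_mono fun y hy => ?_).trans_lt
    (measure_closedBall_lt_top (x := (0 : Fin N → ℂ)) (r := 1))).ne
  have hy' : sumNormSq y < 1 := hy
  rw [mem_closedBall_zero_iff, pi_norm_le_iff_of_nonneg zero_le_one]
  intro i
  have : ‖y i‖ ^ 2 ≤ sumNormSq y :=
    Finset.single_le_sum (f := fun i => ‖y i‖ ^ 2) (fun _ _ => by positivity) (Finset.mem_univ i)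
  nlinarith [norm_nonneg (y i)]

/-- A linear bijection multiplies Lebesgue measure by a constant; the Euclidean unit ball is
invariant and has finite nonzero volume, so the constant is `1`. -/
lemma measurePreserving_mulVec {N : ℕ} {V : Matrix (Fin N) (Fin N) ℂ}
    (hV : V ∈ Matrix.unitaryGroup (Fin N) ℂ) :
    MeasurePreserving (fun y : Fin N → ℂ => V *ᵥ y) volume volume := by
  let f : (Fin N → ℂ) →ₗ[ℝ] (Fin N → ℂ) := (Matrix.toLin' V).restrictScalars ℝ
  let g : (Fin N → ℂ) →ₗ[ℝ] (Fin N → ℂ) := (Matrix.toLin' (star V)).restrictScalars ℝ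
  have hfg : f ∘ₗ g = LinearMap.id := by
    refine LinearMap.ext fun y => ?_
    simp [f, g, Matrix.mulVec_mulVec, Matrix.mem_unitaryGroup_iff.1 hV]
  have hdet : LinearMap.det f ≠ 0 := by
    intro h0
    have := congrArg LinearMap.det hfg
    rw [LinearMap.det_comp, h0, zero_mul, LinearMap.det_id] at this
    exact zero_ne_one this
  have hm : Measurable fun y : Fin N → ℂ => V *ᵥ y := by
    refine Continuous.measurable ?_
    fun_prop
  have hmap : Measure.map (fun y : Fin N → ℂ => V *ᵥ y) volume
      = ENNReal.ofReal |(LinearMap.det f)⁻¹| • (volume : Measure (Fin N → ℂ)) :=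
    Measure.map_linearMap_addHaar_eq_smul_addHaar volume hdet
  refine ⟨hm, ?_⟩
  have hB := congrArg (fun m : Measure (Fin N → ℂ) => m {y | sumNormSq y < 1}) hmap
  simp only [Measure.smul_apply, smul_eq_mul] at hB
  rw [Measure.map_apply hm (isOpen_sumNormSq_lt 1).measurableSet] at hB
  have hpre : (fun y : Fin N → ℂ => V *ᵥ y) ⁻¹' {y | sumNormSq y < 1} = {y | sumNormSq y < 1} := by
    ext y
    simp [sumNormSq_mulVec hV]
  rw [hpre] at hB
  have h1 : ENNReal.ofReal |(LinearMap.det f)⁻¹| = 1 := by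
    refine (ENNReal.mul_left_inj (volume_sumNormSq_lt_one_ne_zero (N := N))
      volume_sumNormSq_lt_one_ne_top).1 ?_
    rw [← hB, one_mul]
  rw [hmap, h1, one_smul]

instance Matrix.unitaryGroup.instSecondCountableTopology {N : ℕ} :
    SecondCountableTopology (Matrix.unitaryGroup (Fin N) ℂ) := by
  have : SecondCountableTopology (Matrix (Fin N) (Fin N) ℂ) :=
    inferInstanceAs (SecondCountableTopology (Fin N → Fin N → ℂ))
  exact TopologicalSpace.Subtype.secondCountableTopology _

/-- A right translate of `μ` is again a Haar probability measure, and such a measure is unique. -/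
lemma MeasureTheory.Measure.isMulRightInvariant_of_compactSpace {G : Type*} [Group G]
    [TopologicalSpace G] [IsTopologicalGroup G] [CompactSpace G] [SecondCountableTopology G]
    [MeasurableSpace G] [BorelSpace G] (μ : Measure G) [μ.IsHaarMeasure] [IsProbabilityMeasure μ] :
    μ.IsMulRightInvariant := by
  refine ⟨fun g => ?_⟩
  have h1 : IsProbabilityMeasure (μ.map (· * g)) :=
    Measure.isProbabilityMeasure_map (measurable_mul_const g).aemeasurable
  exact Measure.isHaarMeasure_eq_of_isProbabilityMeasure _ _

section

variable {n : ℕ} [MeasurableSpace (Matrix.unitaryGroup (Fin (n + 1)) ℂ)]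
  [BorelSpace (Matrix.unitaryGroup (Fin (n + 1)) ℂ)]
  (μ : Measure (Matrix.unitaryGroup (Fin (n + 1)) ℂ)) [μ.IsHaarMeasure] [IsProbabilityMeasure μ]

/-- The normalized vector is the first column of some unitary `R`, so the integrand is a function of
`(V R)₀₀`, and right invariance removes `R`. -/
lemma lintegral_mulVec_div_eq (F : ℂ → ℝ≥0∞) {y : Fin (n + 1) → ℂ} (hy : y ≠ 0) :
    ∫⁻ V, F (((V : Matrix (Fin (n + 1)) (Fin (n + 1)) ℂ) *ᵥ y) 0 / √(sumNormSq y)) ∂μ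
      = ∫⁻ V, F ((V : Matrix (Fin (n + 1)) (Fin (n + 1)) ℂ) 0 0) ∂μ := by
  have := μ.isMulRightInvariant_of_compactSpace
  have hpos := sumNormSq_pos hy
  have hsq : √(sumNormSq y) ≠ 0 := (Real.sqrt_pos.2 hpos).ne'
  obtain ⟨R, hR⟩ := exists_unitaryGroup_apply_zero (x := fun i => y i / √(sumNormSq y)) (by
    have : ∀ i, ‖y i / (√(sumNormSq y) : ℂ)‖ ^ 2 = ‖y i‖ ^ 2 / sumNormSq y := by
      intro i
      rw [norm_div, div_pow, Complex.norm_real, Real.norm_eq_abs, sq_abs, Real.sq_sqrt hpos.le]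
    simp only [this, ← Finset.sum_div]
    exact div_self hpos.ne')
  rw [← lintegral_mul_right_eq_self (fun V : Matrix.unitaryGroup (Fin (n + 1)) ℂ =>
    F ((V : Matrix (Fin (n + 1)) (Fin (n + 1)) ℂ) 0 0)) R]
  refine lintegral_congr fun V => ?_
  congr 1
  simp [Matrix.mul_apply, Matrix.mulVec, dotProduct, hR, Finset.sum_div, mul_div_assoc]

/-- The first entry of a Haar distributed unitary matrix has the law of the first coordinate of a
uniform point of the sphere, here the normalization of a uniform point of the ball. -/
theorem volume_mul_lintegral_apply_zero_zero {F : ℂ → ℝ≥0∞} (hF : Measurable F) :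
    volume {y : Fin (n + 1) → ℂ | sumNormSq y < 1} *
        ∫⁻ V, F ((V : Matrix (Fin (n + 1)) (Fin (n + 1)) ℂ) 0 0) ∂μ
      = ∫⁻ y in {y : Fin (n + 1) → ℂ | sumNormSq y < 1}, F (y 0 / √(sumNormSq y)) := by
  set B := {y : Fin (n + 1) → ℂ | sumNormSq y < 1} with hB
  have hBm : MeasurableSet B := (isOpen_sumNormSq_lt 1).measurableSet
  have hc : Continuous fun p : (Fin (n + 1) → ℂ) × Matrix.unitaryGroup (Fin (n + 1)) ℂ =>
      ((p.2 : Matrix (Fin (n + 1)) (Fin (n + 1)) ℂ) *ᵥ p.1) 0 :=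
    (continuous_apply 0).comp
      ((continuous_subtype_val.comp continuous_snd).matrix_mulVec continuous_fst)
  have hmeas : Measurable fun p : (Fin (n + 1) → ℂ) × Matrix.unitaryGroup (Fin (n + 1)) ℂ =>
      F (((p.2 : Matrix (Fin (n + 1)) (Fin (n + 1)) ℂ) *ᵥ p.1) 0 / √(sumNormSq p.1)) := by
    refine hF.comp (hc.measurable.div ?_)
    exact Complex.measurable_ofReal.comp (by fun_prop)
  calc volume B * ∫⁻ V, F ((V : Matrix (Fin (n + 1)) (Fin (n + 1)) ℂ) 0 0) ∂μ
      = ∫⁻ y in B, ∫⁻ V, F ((V : Matrix (Fin (n + 1)) (Fin (n + 1)) ℂ) 0 0) ∂μ := by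
        rw [setLIntegral_const, mul_comm]
    _ = ∫⁻ y in B, ∫⁻ V, F (((V : Matrix (Fin (n + 1)) (Fin (n + 1)) ℂ) *ᵥ y) 0 / √(sumNormSq y)) ∂μ := by
        refine setLIntegral_congr_fun_ae hBm ?_
        filter_upwards [compl_mem_ae_iff.2 (measure_singleton (0 : Fin (n + 1) → ℂ))] with y hy _
        exact (lintegral_mulVec_div_eq μ F hy).symm
    _ = ∫⁻ V, (∫⁻ y in B,
          F (((V : Matrix (Fin (n + 1)) (Fin (n + 1)) ℂ) *ᵥ y) 0 / √(sumNormSq y))) ∂μ :=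
        lintegral_lintegral_swap hmeas.aemeasurable
    -- After the order of integration is exchanged, each fixed `V` preserves the ball, its volume
    -- and the norm, so `V` can be dropped.
    _ = ∫⁻ _, (∫⁻ y in B, F (y 0 / √(sumNormSq y))) ∂μ := by
        refine lintegral_congr fun V => ?_
        have h := (measurePreserving_mulVec V.2).restrict_preimage hBm
        have hpre : (fun y : Fin (n + 1) → ℂ => (V : Matrix (Fin (n + 1)) (Fin (n + 1)) ℂ) *ᵥ y) ⁻¹' B = B := by
          ext y
          simp [hB, sumNormSq_mulVec V.2]
        rw [hpre] at h
        have hm : Measurable fun y : Fin (n + 1) → ℂ => F (y 0 / √(sumNormSq y)) :=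
          hF.comp ((measurable_pi_apply 0).div (Complex.measurable_ofReal.comp (by fun_prop)))
        simpa only [sumNormSq_mulVec V.2] using h.lintegral_comp hm
    _ = ∫⁻ y in B, F (y 0 / √(sumNormSq y)) := by simp

end

/-! ### Changes of variables -/

section ChangeOfVariables

lemma setLIntegral_eq_of_subset_of_eq_zero {α : Type*} [MeasurableSpace α] {μ : Measure α}
    {s t : Set α} (hs : MeasurableSet s) (ht : MeasurableSet t) (hst : s ⊆ t) {f : α → ℝ≥0∞}
    (h : ∀ x ∈ t \ s, f x = 0) : ∫⁻ x in t, f x ∂μ = ∫⁻ x in s, f x ∂μ := by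
  rw [← lintegral_indicator ht, ← lintegral_indicator hs]
  refine lintegral_congr fun x => ?_
  by_cases hx : x ∈ s
  · rw [Set.indicator_of_mem hx, Set.indicator_of_mem (hst hx)]
  · rw [Set.indicator_of_notMem hx]
    by_cases hx' : x ∈ t
    · rw [Set.indicator_of_mem hx', h x ⟨hx', hx⟩]
    · rw [Set.indicator_of_notMem hx']

lemma Complex.lintegral_eq_lintegral_polar {f : ℂ → ℝ≥0∞} (hf : Measurable f) :
    ∫⁻ z, f z = ∫⁻ φ in Set.Ioo (-Real.pi) Real.pi, ∫⁻ r in Set.Ioi (0 : ℝ),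
      ENNReal.ofReal r * f (r * Complex.exp (φ * Complex.I)) := by
  rw [← Complex.lintegral_comp_polarCoord_symm, polarCoord_target, Measure.volume_eq_prod,
    ← Measure.prod_restrict, lintegral_prod_symm]
  · refine lintegral_congr fun φ => lintegral_congr fun r => ?_
    rw [smul_eq_mul, Complex.polarCoord_symm_apply, Complex.exp_mul_I, Complex.ofReal_cos,
      Complex.ofReal_sin]
  · simp only [Complex.polarCoord_symm_apply]
    fun_prop

/-- The substitution inverts `a = r / √(r² + t)`: if `r` is the modulus of one coordinate and `t`
the squared norm of the others, `a` is the modulus of that coordinate after projection to the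
sphere. -/
lemma lintegral_Ioi_mul_eq_lintegral_Ioo {t : ℝ} (ht : 0 < t) (h : ℝ → ℝ≥0∞) :
    ∫⁻ r in Set.Ioi (0 : ℝ), ENNReal.ofReal r * h r
      = ∫⁻ a in Set.Ioo (0 : ℝ) 1,
          ENNReal.ofReal (t * a / (1 - a ^ 2) ^ 2) * h (√t * a / √(1 - a ^ 2)) := by
  let f : ℝ → ℝ := fun a => √t * a / √(1 - a ^ 2)
  have hst : 0 < √t := Real.sqrt_pos.2 ht
  have hpos {a : ℝ} (ha : a ∈ Set.Ioo (0 : ℝ) 1) : 0 < 1 - a ^ 2 := by nlinarith [ha.1, ha.2]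
  have hsq {a : ℝ} (ha : a ∈ Set.Ioo (0 : ℝ) 1) : f a ^ 2 = t * a ^ 2 / (1 - a ^ 2) := by
    simp only [f, div_pow, mul_pow]
    rw [Real.sq_sqrt ht.le, Real.sq_sqrt (hpos ha).le]
  have himg : f '' Set.Ioo 0 1 = Set.Ioi 0 := by
    ext r
    constructor
    · rintro ⟨a, ha, rfl⟩
      have := Real.sqrt_pos.2 (hpos ha)
      exact div_pos (mul_pos hst ha.1) this
    · intro hr
      have hr : 0 < r := hr
      have h1 : 0 < r ^ 2 + t := by positivity
      have h2 : 0 < √(r ^ 2 + t) := Real.sqrt_pos.2 h1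
      have ha : r / √(r ^ 2 + t) ∈ Set.Ioo (0 : ℝ) 1 := by
        refine ⟨by positivity, (div_lt_one h2).2 ?_⟩
        exact Real.lt_sqrt_of_sq_lt (by linarith)
      refine ⟨r / √(r ^ 2 + t), ha, ?_⟩
      have h3 : 1 - (r / √(r ^ 2 + t)) ^ 2 = t / (r ^ 2 + t) := by
        rw [div_pow, Real.sq_sqrt h1.le]
        field_simp
        ring
      simp only [f, h3]
      rw [Real.sqrt_div ht.le]
      field_simp
  have hinj : Set.InjOn f (Set.Ioo 0 1) := by
    intro a ha b hb hab
    have h1 := congrArg (· ^ 2) hab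
    simp only [hsq ha, hsq hb] at h1
    rw [div_eq_div_iff (hpos ha).ne' (hpos hb).ne'] at h1
    have h2 : t * (a ^ 2 - b ^ 2) = 0 := by linarith
    have h3 : a ^ 2 = b ^ 2 := by
      rcases mul_eq_zero.1 h2 with h | h <;> linarith
    exact (pow_left_inj₀ ha.1.le hb.1.le two_ne_zero).1 h3
  have hder : ∀ a ∈ Set.Ioo (0 : ℝ) 1,
      HasDerivWithinAt f (√t / (√(1 - a ^ 2) * (1 - a ^ 2))) (Set.Ioo 0 1) a := by
    intro a ha
    have h0 := hpos ha
    have h1 := Real.sqrt_pos.2 h0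
    have h2 : HasDerivAt (fun a : ℝ => √(1 - a ^ 2)) (-(2 * a) / (2 * √(1 - a ^ 2))) a := by
      have := ((hasDerivAt_id a).pow 2).const_sub 1
      simpa using this.sqrt h0.ne'
    have h3 := (((hasDerivAt_id a).const_mul √t).div h2 h1.ne').hasDerivWithinAt
      (s := Set.Ioo 0 1)
    refine h3.congr_deriv ?_
    simp only [id]
    field_simp
    rw [Real.sq_sqrt h0.le]
    ring
  rw [← himg, lintegral_image_eq_lintegral_abs_deriv_mul measurableSet_Ioo hder hinj]
  refine setLIntegral_congr_fun measurableSet_Ioo fun a ha => ?_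
  have h0 := hpos ha
  have h1 := Real.sqrt_pos.2 h0
  rw [← mul_assoc, ← ENNReal.ofReal_mul (abs_nonneg _), abs_of_pos (by positivity)]
  congr 2
  simp only [f]
  have h4 := Real.sq_sqrt h0.le
  have h5 := Real.sq_sqrt ht.le
  rw [div_mul_div_comm, div_eq_div_iff (by positivity) (by positivity)]
  calc √t * (√t * a) * (1 - a ^ 2) ^ 2 = √t ^ 2 * a * (1 - a ^ 2) ^ 2 := by ring
    _ = t * a * (1 - a ^ 2) ^ 2 := by rw [h5]
    _ = t * a * (√(1 - a ^ 2) ^ 2 * (1 - a ^ 2)) := by rw [h4]; ring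
    _ = _ := by ring

lemma lintegral_Ioo_comp_mul_left {c : ℝ} (hc : 0 < c) (g : ℝ → ℝ≥0∞) :
    ∫⁻ r in Set.Ioo 0 c, g r = ∫⁻ b in Set.Ioo (0 : ℝ) 1, ENNReal.ofReal c * g (c * b) := by
  have himg : (fun b => c * b) '' Set.Ioo (0 : ℝ) 1 = Set.Ioo 0 c := by
    rw [Set.image_mul_left_Ioo hc]
    simp
  rw [← himg, lintegral_image_eq_lintegral_abs_deriv_mul (f' := fun _ => c) measurableSet_Ioo
    (fun b _ => by simpa using ((hasDerivAt_id b).const_mul c).hasDerivWithinAt)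
    (fun a _ b _ h => mul_left_cancel₀ hc.ne' h), abs_of_pos hc]

/-- Integration of a function of `z / √(|z|² + t)` over the disc of radius `√(1 - t)`. -/
lemma lintegral_div_sqrt_norm_sq_add {F : ℂ → ℝ≥0∞} (hF : Measurable F) {t : ℝ} (ht : 0 < t) :
    ∫⁻ z in {z : ℂ | ‖z‖ ^ 2 + t < 1}, F (z / √(‖z‖ ^ 2 + t))
      = ∫⁻ α in {α : ℂ | t < 1 - ‖α‖ ^ 2}, ENNReal.ofReal (t / (1 - ‖α‖ ^ 2) ^ 2) * F α := by
  have hm1 : MeasurableSet {z : ℂ | ‖z‖ ^ 2 + t < 1} :=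
    measurableSet_lt (by fun_prop) measurable_const
  have hm2 : MeasurableSet {α : ℂ | t < 1 - ‖α‖ ^ 2} :=
    measurableSet_lt measurable_const (by fun_prop)
  rw [← lintegral_indicator hm1, ← lintegral_indicator hm2,
    Complex.lintegral_eq_lintegral_polar (by
      refine Measurable.indicator (hF.comp (measurable_id.div ?_)) hm1
      exact Complex.measurable_ofReal.comp (by fun_prop)),
    Complex.lintegral_eq_lintegral_polar (by
      refine Measurable.indicator (Measurable.mul ?_ hF) hm2
      exact ENNReal.measurable_ofReal.comp (by fun_prop))]
  refine lintegral_congr fun φ => ?_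
  have hn {r : ℝ} (hr : 0 < r) : ‖(r : ℂ) * Complex.exp (φ * Complex.I)‖ = r := by
    rw [norm_mul, Complex.norm_exp_ofReal_mul_I, mul_one, Complex.norm_real,
      Real.norm_of_nonneg hr.le]
  rw [lintegral_Ioi_mul_eq_lintegral_Ioo ht]
  have hIoo : ∫⁻ r in Set.Ioi (0 : ℝ), ENNReal.ofReal r *
        Set.indicator {α : ℂ | t < 1 - ‖α‖ ^ 2}
          (fun α => ENNReal.ofReal (t / (1 - ‖α‖ ^ 2) ^ 2) * F α)
          (r * Complex.exp (φ * Complex.I))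
      = ∫⁻ r in Set.Ioo (0 : ℝ) 1, ENNReal.ofReal r *
        Set.indicator {α : ℂ | t < 1 - ‖α‖ ^ 2}
          (fun α => ENNReal.ofReal (t / (1 - ‖α‖ ^ 2) ^ 2) * F α)
          (r * Complex.exp (φ * Complex.I)) := by
    refine setLIntegral_eq_of_subset_of_eq_zero measurableSet_Ioo measurableSet_Ioi
      Set.Ioo_subset_Ioi_self fun r hr => ?_
    have hr0 : 0 < r := hr.1
    have hr1 : 1 ≤ r := not_lt.1 fun h => hr.2 ⟨hr0, h⟩
    rw [Set.indicator_of_notMem, mul_zero]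
    intro h
    have h' : t < 1 - ‖(r : ℂ) * Complex.exp (φ * Complex.I)‖ ^ 2 := h
    rw [hn hr0] at h'
    nlinarith
  rw [hIoo]
  refine setLIntegral_congr_fun measurableSet_Ioo fun a ha => ?_
  have ha0 := ha.1
  have h0 : 0 < 1 - a ^ 2 := by nlinarith [ha.1, ha.2]
  have h1 := Real.sqrt_pos.2 h0
  have hst : 0 < √t := Real.sqrt_pos.2 ht
  have hr : 0 < √t * a / √(1 - a ^ 2) := by positivity
  -- In the new variable the squared norm `r² + t` is `t / (1 - a²)`, so the ball condition becomes
  -- `t < 1 - a²`.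
  have hsum : (√t * a / √(1 - a ^ 2)) ^ 2 + t = t / (1 - a ^ 2) := by
    rw [div_pow, mul_pow, Real.sq_sqrt ht.le, Real.sq_sqrt h0.le]
    field_simp
    ring
  by_cases hlt : t < 1 - a ^ 2
  · rw [Set.indicator_of_mem, Set.indicator_of_mem, hn hr, hn ha0, hsum, ← mul_assoc,
      ← ENNReal.ofReal_mul ha0.le]
    · congr 2
      · ring
      · have h3 : √(1 - a ^ 2) ≠ 0 := h1.ne'
        have h4 : √t ≠ 0 := hst.ne'
        rw [Real.sqrt_div ht.le]
        push_cast
        have h3' : (√(1 - a ^ 2) : ℂ) ≠ 0 := by exact_mod_cast h3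
        have h4' : (√t : ℂ) ≠ 0 := by exact_mod_cast h4
        field_simp
    · change t < 1 - ‖(a : ℂ) * Complex.exp (φ * Complex.I)‖ ^ 2
      rwa [hn ha0]
    · change ‖((√t * a / √(1 - a ^ 2) : ℝ) : ℂ) * Complex.exp (φ * Complex.I)‖ ^ 2 + t < 1
      rw [hn hr, hsum]
      exact (div_lt_one h0).2 hlt
  · rw [Set.indicator_of_notMem, Set.indicator_of_notMem, mul_zero, mul_zero]
    · intro h
      have h' : t < 1 - ‖(a : ℂ) * Complex.exp (φ * Complex.I)‖ ^ 2 := h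
      rw [hn ha0] at h'
      exact hlt h'
    · intro h
      have h' : ‖((√t * a / √(1 - a ^ 2) : ℝ) : ℂ) * Complex.exp (φ * Complex.I)‖ ^ 2 + t < 1 := h
      rw [hn hr, hsum, div_lt_one h0] at h'
      exact hlt h'

/-- Scaling by `√u` in real dimension `2n` contributes `u ^ n`, and the quadratic integrand one more
factor `u`. -/
lemma lintegral_sumNormSq_lt {n : ℕ} {u : ℝ} (hu : 0 < u) :
    ∫⁻ y in {y : Fin n → ℂ | sumNormSq y < u}, ENNReal.ofReal (sumNormSq y)
      = ENNReal.ofReal (u ^ (n + 1)) *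
        ∫⁻ y in {y : Fin n → ℂ | sumNormSq y < 1}, ENNReal.ofReal (sumNormSq y) := by
  have hsu : √u ≠ 0 := (Real.sqrt_pos.2 hu).ne'
  have hsq := Real.sq_sqrt hu.le
  have hmap := Measure.map_addHaar_smul (volume : Measure (Fin n → ℂ)) hsu
  have hfr : Module.finrank ℝ (Fin n → ℂ) = 2 * n := by
    rw [Module.finrank_pi_fintype]
    simp [mul_comm]
  rw [hfr, pow_mul, hsq, abs_of_pos (by positivity)] at hmap
  have hmu := (isOpen_sumNormSq_lt (N := n) u).measurableSet
  have hm1 := (isOpen_sumNormSq_lt (N := n) 1).measurableSet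
  have h := congrArg (fun m : Measure (Fin n → ℂ) => ∫⁻ y, Set.indicator
    {y | sumNormSq y < u} (fun y => ENNReal.ofReal (sumNormSq y)) y ∂m) hmap
  have hmeas : Measurable (Set.indicator {y : Fin n → ℂ | sumNormSq y < u}
      (fun y => ENNReal.ofReal (sumNormSq y))) :=
    Measurable.indicator (by fun_prop) hmu
  simp only [lintegral_smul_measure, smul_eq_mul] at h
  rw [lintegral_map hmeas (measurable_const_smul _), lintegral_indicator hmu] at h
  have hl : ∀ y : Fin n → ℂ, Set.indicator {y | sumNormSq y < u}
      (fun y => ENNReal.ofReal (sumNormSq y)) (√u • y)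
      = ENNReal.ofReal u * Set.indicator {y | sumNormSq y < 1}
        (fun y => ENNReal.ofReal (sumNormSq y)) y := by
    intro y
    have hs : sumNormSq (√u • y) = u * sumNormSq y := by rw [sumNormSq_smul, hsq]
    by_cases hy : sumNormSq y < 1
    · rw [Set.indicator_of_mem (by simpa [hs] using (mul_lt_iff_lt_one_right hu).2 hy),
        Set.indicator_of_mem (by simpa using hy), hs, ENNReal.ofReal_mul hu.le]
    · rw [Set.indicator_of_notMem, Set.indicator_of_notMem (by simpa using hy), mul_zero]
      simp only [Set.mem_ofPred_eq, hs]
      exact fun h => hy ((mul_lt_iff_lt_one_right hu).1 h)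
  simp only [hl] at h
  rw [lintegral_const_mul _ (Measurable.indicator (by fun_prop) hm1), lintegral_indicator hm1] at h
  have h2 := congrArg (fun x => ENNReal.ofReal (u ^ n) * x) h
  simp only [← mul_assoc] at h2
  rw [← ENNReal.ofReal_mul (by positivity), ← ENNReal.ofReal_mul (by positivity),
    mul_inv_cancel₀ (by positivity), ENNReal.ofReal_one, one_mul, ← pow_succ] at h2
  exact h2.symm

lemma lintegral_sumNormSq_lt_one_eq {n : ℕ} {F : ℂ → ℝ≥0∞} (hF : Measurable F) :
    ∫⁻ y in {y : Fin (n + 1) → ℂ | sumNormSq y < 1}, F (y 0 / √(sumNormSq y))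
      = ∫⁻ y : Fin n → ℂ, ∫⁻ z in {z : ℂ | ‖z‖ ^ 2 + sumNormSq y < 1},
          F (z / √(‖z‖ ^ 2 + sumNormSq y)) := by
  have hm := (isOpen_sumNormSq_lt (N := n + 1) 1).measurableSet
  have hmeas : Measurable (Set.indicator {y : Fin (n + 1) → ℂ | sumNormSq y < 1}
      fun y => F (y 0 / √(sumNormSq y))) := by
    refine Measurable.indicator (hF.comp ((measurable_pi_apply 0).div ?_)) hm
    exact Complex.measurable_ofReal.comp (by fun_prop)
  have hmp := (volume_preserving_piFinSuccAbove (fun _ : Fin (n + 1) => ℂ) 0).symm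
  rw [← lintegral_indicator hm, ← hmp.lintegral_comp hmeas, Measure.volume_eq_prod]
  have hmeas' := hmeas.comp hmp.measurable
  simp only [Function.comp_def] at hmeas'
  rw [lintegral_prod_symm _ hmeas'.aemeasurable]
  refine lintegral_congr fun y => ?_
  rw [← lintegral_indicator (measurableSet_lt (by fun_prop) measurable_const)]
  refine lintegral_congr fun z => ?_
  have h : (MeasurableEquiv.piFinSuccAbove (fun _ : Fin (n + 1) => ℂ) 0).symm (z, y)
      = Fin.cons z y := by
    simp [MeasurableEquiv.piFinSuccAbove]
    rfl
  rw [h]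
  simp only [Set.indicator, Set.mem_ofPred_eq, sumNormSq_cons, Fin.cons_zero]

end ChangeOfVariables

/-! ### The cosine and beta laws as integrals -/

section Laws

/-- Wallis' recursion: in the reduction formula the boundary terms vanish with the cosine at `±π/2`.
-/
lemma integral_cos_pow_even_neg_pi_div_two_pi_div_two (n : ℕ) :
    ∫ v in (-(Real.pi / 2))..(Real.pi / 2), Real.cos v ^ (2 * n)
      = Real.pi * ((2 * n).factorial : ℝ) / (2 ^ (2 * n) * (n.factorial : ℝ) ^ 2) := by
  induction n with
  | zero => simp
  | succ k ih =>
    rw [show 2 * (k + 1) = 2 * k + 2 by ring, integral_cos_pow, ih]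
    have h1 : ((2 * k + 2).factorial : ℝ) = (2 * k + 2) * ((2 * k + 1) * (2 * k).factorial) := by
      rw [Nat.factorial_succ, Nat.factorial_succ]
      push_cast
      ring
    have h2 : ((k + 1).factorial : ℝ) = (k + 1) * k.factorial := by
      rw [Nat.factorial_succ]
      push_cast
      ring
    rw [h1, h2]
    simp only [Real.cos_neg, Real.cos_pi_div_two]
    have := Nat.factorial_ne_zero k
    push_cast
    field_simp
    ring

/-- The normalizing constant of the density of `cosLaw (n + 1)`. -/
noncomputable def cosLawConst (n : ℕ) : ℝ :=
  (2 : ℝ) ^ (2 * n) * (n.factorial : ℝ) ^ 2 / (Real.pi * ((2 * n).factorial : ℝ))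

lemma cosLawConst_pos (n : ℕ) : 0 < cosLawConst n := by
  have := Real.pi_pos
  unfold cosLawConst
  positivity

lemma lintegral_cosLaw (n : ℕ) {f : ℝ → ℝ≥0∞} (hf : Measurable f) :
    ∫⁻ w, f w ∂(cosLaw (n + 1)) = ENNReal.ofReal (cosLawConst n) *
      ∫⁻ w in Set.Ioo (-(Real.pi / 2)) (Real.pi / 2),
        ENNReal.ofReal (Real.cos w ^ (2 * n)) * f w := by
  have hd : (fun v : ℝ => ENNReal.ofReal
      ((Set.Ioo (-(Real.pi / 2)) (Real.pi / 2)).indicator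
        (fun v => (2 : ℝ) ^ (2 * (n + 1 - 1)) * ((n + 1 - 1).factorial : ℝ) ^ 2
          / (Real.pi * ((2 * (n + 1) - 2).factorial : ℝ)) * Real.cos v ^ (2 * (n + 1 - 1))) v))
      = (Set.Ioo (-(Real.pi / 2)) (Real.pi / 2)).indicator
        fun v => ENNReal.ofReal (cosLawConst n) * ENNReal.ofReal (Real.cos v ^ (2 * n)) := by
    funext v
    by_cases hv : v ∈ Set.Ioo (-(Real.pi / 2)) (Real.pi / 2)
    · rw [Set.indicator_of_mem hv, Set.indicator_of_mem hv,
        ← ENNReal.ofReal_mul (cosLawConst_pos n).le]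
      rfl
    · rw [Set.indicator_of_notMem hv, Set.indicator_of_notMem hv, ENNReal.ofReal_zero]
  have hm : Measurable ((Set.Ioo (-(Real.pi / 2)) (Real.pi / 2)).indicator
        fun v => ENNReal.ofReal (cosLawConst n) * ENNReal.ofReal (Real.cos v ^ (2 * n))) :=
    Measurable.indicator (by fun_prop) measurableSet_Ioo
  rw [cosLaw, hd, lintegral_withDensity_eq_lintegral_mul _ hm hf, ← lintegral_const_mul _ (by fun_prop),
    ← lintegral_indicator measurableSet_Ioo]
  refine lintegral_congr fun v => ?_
  by_cases hv : v ∈ Set.Ioo (-(Real.pi / 2)) (Real.pi / 2)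
  · rw [Pi.mul_apply, Set.indicator_of_mem hv, Set.indicator_of_mem hv, mul_assoc]
  · rw [Pi.mul_apply, Set.indicator_of_notMem hv, Set.indicator_of_notMem hv, zero_mul]

instance isProbabilityMeasure_cosLaw (n : ℕ) : IsProbabilityMeasure (cosLaw (n + 1)) := by
  have hle : -(Real.pi / 2) ≤ Real.pi / 2 := by linarith [Real.pi_pos]
  refine ⟨?_⟩
  rw [← lintegral_one, lintegral_cosLaw n measurable_const]
  simp only [mul_one]
  rw [← ofReal_integral_eq_lintegral_ofReal, ← integral_Ioc_eq_integral_Ioo,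
    ← intervalIntegral.integral_of_le hle, integral_cos_pow_even_neg_pi_div_two_pi_div_two,
    ← ENNReal.ofReal_mul (cosLawConst_pos n).le, ← ENNReal.ofReal_one]
  · congr 1
    unfold cosLawConst
    have := Real.pi_pos
    have := (2 * n).factorial_pos
    have := n.factorial_pos
    field_simp
  · exact ((Continuous.integrableOn_Icc (by fun_prop)).mono_set Set.Ioo_subset_Icc_self)
  · exact ae_of_all _ fun v => Even.pow_nonneg (even_two_mul n) _

instance isProbabilityMeasure_betaLaw (n : ℕ) : IsProbabilityMeasure (betaLaw (n + 1)) := by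
  unfold betaLaw
  split_ifs with h
  · infer_instance
  · have : 0 < n := by lia
    refine isProbabilityMeasureBeta (by positivity) ?_
    push_cast
    simpa using this

lemma betaLaw_one : betaLaw 1 = Measure.dirac 1 := if_pos rfl

/-- Starting at index `m + 2` avoids the Dirac case and turns the real exponents of the beta density
into the natural numbers `m + 1` and `m`. -/
lemma lintegral_betaLaw (m : ℕ) {f : ℝ → ℝ≥0∞} (hf : Measurable f) :
    ∫⁻ b, f b ∂(betaLaw (m + 2)) =
      ENNReal.ofReal (1 / ProbabilityTheory.beta ((m + 2 : ℕ) : ℝ) (((m + 2 : ℕ) : ℝ) - 1)) *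
      ∫⁻ b in Set.Ioo (0 : ℝ) 1, ENNReal.ofReal (b ^ (m + 1) * (1 - b) ^ m) * f b := by
  set c := 1 / ProbabilityTheory.beta ((m + 2 : ℕ) : ℝ) (((m + 2 : ℕ) : ℝ) - 1) with hc
  have hc0 : 0 ≤ c := by
    refine (one_div_pos.2 (beta_pos (by positivity) ?_)).le
    push_cast
    have : (0 : ℝ) ≤ m := by positivity
    linarith
  have hd : betaPDF ((m + 2 : ℕ) : ℝ) (((m + 2 : ℕ) : ℝ) - 1) = (Set.Ioo (0 : ℝ) 1).indicator
      fun b => ENNReal.ofReal c * ENNReal.ofReal (b ^ (m + 1) * (1 - b) ^ m) := by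
    funext b
    by_cases hb : b ∈ Set.Ioo (0 : ℝ) 1
    · rw [Set.indicator_of_mem hb, betaPDF_of_pos_lt_one hb.1 hb.2, ← ENNReal.ofReal_mul hc0,
        ← hc, mul_assoc]
      have h1 : (((m + 2 : ℕ) : ℝ) - 1) = ((m + 1 : ℕ) : ℝ) := by push_cast; ring
      have h2 : (((m + 1 : ℕ) : ℝ) - 1) = (m : ℝ) := by push_cast; ring
      rw [h1, h2, Real.rpow_natCast, Real.rpow_natCast]
    · rw [Set.indicator_of_notMem hb, betaPDF_eq, if_neg (show ¬(0 < b ∧ b < 1) from hb),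
        ENNReal.ofReal_zero]
  have hm : Measurable ((Set.Ioo (0 : ℝ) 1).indicator
      fun b => ENNReal.ofReal c * ENNReal.ofReal (b ^ (m + 1) * (1 - b) ^ m)) :=
    Measurable.indicator (by fun_prop) measurableSet_Ioo
  rw [betaLaw, if_neg (by lia), betaMeasure, hd, lintegral_withDensity_eq_lintegral_mul _ hm hf,
    ← lintegral_const_mul _ (by fun_prop), ← lintegral_indicator measurableSet_Ioo]
  refine lintegral_congr fun b => ?_
  by_cases hb : b ∈ Set.Ioo (0 : ℝ) 1
  · rw [Pi.mul_apply, Set.indicator_of_mem hb, Set.indicator_of_mem hb, mul_assoc]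
  · rw [Pi.mul_apply, Set.indicator_of_notMem hb, Set.indicator_of_notMem hb, zero_mul]

end Laws

/-! ### The law of `1 - V₀₀` in polar coordinates about the point `1` -/

/-- The law of the first coordinate of a uniform point of the sphere has a density proportional to
`(1 - |α|²) ^ m` on the unit disc. -/
lemma lintegral_sumNormSq_lt_one_eq_disc (m : ℕ) {F : ℂ → ℝ≥0∞} (hF : Measurable F) :
    ∫⁻ y in {y : Fin (m + 2) → ℂ | sumNormSq y < 1}, F (y 0 / √(sumNormSq y))
      = (∫⁻ y in {y : Fin (m + 1) → ℂ | sumNormSq y < 1}, ENNReal.ofReal (sumNormSq y)) *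
        ∫⁻ α in {α : ℂ | 0 < 1 - ‖α‖ ^ 2}, ENNReal.ofReal ((1 - ‖α‖ ^ 2) ^ m) * F α := by
  rw [lintegral_sumNormSq_lt_one_eq hF]
  set J := ∫⁻ y in {y : Fin (m + 1) → ℂ | sumNormSq y < 1}, ENNReal.ofReal (sumNormSq y) with hJ
  have hmα (t : ℝ) : MeasurableSet {α : ℂ | t < 1 - ‖α‖ ^ 2} :=
    measurableSet_lt measurable_const (by fun_prop)
  have hmy (u : ℝ) : MeasurableSet {y : Fin (m + 1) → ℂ | sumNormSq y < u} :=
    (isOpen_sumNormSq_lt u).measurableSet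
  let g : (Fin (m + 1) → ℂ) → ℂ → ℝ≥0∞ := fun y α =>
    Set.indicator {p : (Fin (m + 1) → ℂ) × ℂ | sumNormSq p.1 < 1 - ‖p.2‖ ^ 2}
      (fun p => ENNReal.ofReal (sumNormSq p.1 / (1 - ‖p.2‖ ^ 2) ^ 2) * F p.2) (y, α)
  have hg : Measurable (Function.uncurry g) := by
    have : Function.uncurry g = Set.indicator
        {p : (Fin (m + 1) → ℂ) × ℂ | sumNormSq p.1 < 1 - ‖p.2‖ ^ 2}
        (fun p => ENNReal.ofReal (sumNormSq p.1 / (1 - ‖p.2‖ ^ 2) ^ 2) * F p.2) := rfl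
    rw [this]
    exact Measurable.indicator (by fun_prop) (measurableSet_lt (by fun_prop) (by fun_prop))
  calc ∫⁻ y : Fin (m + 1) → ℂ, ∫⁻ z in {z : ℂ | ‖z‖ ^ 2 + sumNormSq y < 1},
          F (z / √(‖z‖ ^ 2 + sumNormSq y))
      = ∫⁻ y : Fin (m + 1) → ℂ, ∫⁻ α, g y α := by
        -- The null point `y = 0` is discarded, since the substitution requires `t > 0`.
        refine lintegral_congr_ae ?_
        filter_upwards [compl_mem_ae_iff.2 (measure_singleton (0 : Fin (m + 1) → ℂ))] with y hy
        rw [lintegral_div_sqrt_norm_sq_add hF (sumNormSq_pos hy), ← lintegral_indicator (hmα _)]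
        rfl
    _ = ∫⁻ α, ∫⁻ y : Fin (m + 1) → ℂ, g y α := lintegral_lintegral_swap hg.aemeasurable
    _ = ∫⁻ α, J * Set.indicator {α : ℂ | 0 < 1 - ‖α‖ ^ 2}
          (fun α => ENNReal.ofReal ((1 - ‖α‖ ^ 2) ^ m) * F α) α := by
        refine lintegral_congr fun α => ?_
        by_cases hα : 0 < 1 - ‖α‖ ^ 2
        · rw [Set.indicator_of_mem (show α ∈ {α : ℂ | 0 < 1 - ‖α‖ ^ 2} from hα)]
          have h1 : ∀ y, g y α = ENNReal.ofReal (((1 - ‖α‖ ^ 2) ^ 2)⁻¹) * F α *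
              Set.indicator {y : Fin (m + 1) → ℂ | sumNormSq y < 1 - ‖α‖ ^ 2}
                (fun y => ENNReal.ofReal (sumNormSq y)) y := by
            intro y
            by_cases hy : sumNormSq y < 1 - ‖α‖ ^ 2
            · have h2 : g y α
                  = ENNReal.ofReal (sumNormSq y / (1 - ‖α‖ ^ 2) ^ 2) * F α :=
                Set.indicator_of_mem (show (y, α) ∈ _ from hy) _
              rw [h2, Set.indicator_of_mem (show y ∈ {y | sumNormSq y < 1 - ‖α‖ ^ 2} from hy), div_eq_mul_inv,
                ENNReal.ofReal_mul (sumNormSq_nonneg y)]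
              ring
            · have h2 : g y α = 0 := Set.indicator_of_notMem (show (y, α) ∉ _ from hy) _
              rw [h2, Set.indicator_of_notMem (show y ∉ {y | sumNormSq y < 1 - ‖α‖ ^ 2} from hy), mul_zero]
          simp only [h1]
          rw [lintegral_const_mul _ (Measurable.indicator (by fun_prop) (hmy _)),
            lintegral_indicator (hmy _), lintegral_sumNormSq_lt hα, ← hJ]
          -- Scaling the ball in `m + 1` complex dimensions gives the power `m + 2`; the Jacobian
          -- takes away two.
          have h3 : ENNReal.ofReal ((1 - ‖α‖ ^ 2) ^ m)
              = ENNReal.ofReal (((1 - ‖α‖ ^ 2) ^ 2)⁻¹) *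
                ENNReal.ofReal ((1 - ‖α‖ ^ 2) ^ (m + 1 + 1)) := by
            rw [← ENNReal.ofReal_mul (by positivity)]
            congr 1
            rw [add_assoc, pow_add]
            field_simp
          rw [h3]
          ring
        · rw [Set.indicator_of_notMem (show α ∉ {α : ℂ | 0 < 1 - ‖α‖ ^ 2} from hα), mul_zero]
          have h1 : ∀ y, g y α = 0 := by
            intro y
            refine Set.indicator_of_notMem (fun h => hα ?_) _
            have h' : sumNormSq y < 1 - ‖α‖ ^ 2 := h
            exact (sumNormSq_nonneg y).trans_lt h'
          simp [h1]
    _ = J * ∫⁻ α in {α : ℂ | 0 < 1 - ‖α‖ ^ 2}, ENNReal.ofReal ((1 - ‖α‖ ^ 2) ^ m) * F α := by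
        rw [lintegral_const_mul _ (Measurable.indicator (by fun_prop) (hmα 0)),
          lintegral_indicator (hmα 0)]

/-- Seen from the boundary point `1`, the disc is `0 < r < 2 cos φ`, and the weight factors
accordingly. -/
lemma Complex.one_sub_norm_one_sub_mul_exp_sq (r φ : ℝ) :
    1 - ‖1 - (r : ℂ) * Complex.exp (φ * Complex.I)‖ ^ 2 = r * (2 * Real.cos φ - r) := by
  rw [Complex.sq_norm, Complex.normSq_apply]
  simp only [Complex.exp_mul_I, ← Complex.ofReal_cos, ← Complex.ofReal_sin, Complex.sub_re,
    Complex.sub_im, Complex.mul_re, Complex.mul_im, Complex.add_re, Complex.add_im,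
    Complex.ofReal_re, Complex.ofReal_im, Complex.I_re, Complex.I_im, Complex.one_re,
    Complex.one_im]
  linear_combination -(r ^ 2) * (Real.cos_sq_add_sin_sq φ)

/-- Polar coordinates about the boundary point `1` of the disc, the radius being measured in units
of the length `2 cos w` of the chord in the direction `w`. -/
lemma lintegral_disc_eq_lintegral_chord (m : ℕ) {F : ℂ → ℝ≥0∞} (hF : Measurable F) :
    ∫⁻ α in {α : ℂ | 0 < 1 - ‖α‖ ^ 2}, ENNReal.ofReal ((1 - ‖α‖ ^ 2) ^ m) * F (1 - α)
      = ∫⁻ w in Set.Ioo (-(Real.pi / 2)) (Real.pi / 2), ∫⁻ b in Set.Ioo (0 : ℝ) 1,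
          ENNReal.ofReal ((2 * Real.cos w) ^ (2 * m + 2)) *
            (ENNReal.ofReal (b ^ (m + 1) * (1 - b) ^ m) *
              F ((b * (2 * Real.cos w) : ℝ) * Complex.exp (w * Complex.I))) := by
  have hpi := Real.pi_pos
  have hm0 : MeasurableSet {α : ℂ | 0 < 1 - ‖α‖ ^ 2} :=
    measurableSet_lt measurable_const (by fun_prop)
  have hm1 : MeasurableSet {z : ℂ | 0 < 1 - ‖1 - z‖ ^ 2} :=
    measurableSet_lt measurable_const (by fun_prop)
  let f : ℂ → ℝ≥0∞ := Set.indicator {z : ℂ | 0 < 1 - ‖1 - z‖ ^ 2}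
    fun z => ENNReal.ofReal ((1 - ‖1 - z‖ ^ 2) ^ m) * F z
  have hf : Measurable f := Measurable.indicator (by fun_prop) hm1
  have h1 : ∫⁻ α in {α : ℂ | 0 < 1 - ‖α‖ ^ 2}, ENNReal.ofReal ((1 - ‖α‖ ^ 2) ^ m) * F (1 - α)
      = ∫⁻ z, f z := by
    rw [← lintegral_sub_left_eq_self f 1, ← lintegral_indicator hm0]
    refine lintegral_congr fun α => ?_
    simp only [f, Set.indicator, Set.mem_ofPred_eq, sub_sub_cancel]
  rw [h1, Complex.lintegral_eq_lintegral_polar hf]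
  have hfz {r φ : ℝ} (h : r * (2 * Real.cos φ - r) ≤ 0) :
      f (r * Complex.exp (φ * Complex.I)) = 0 := by
    refine Set.indicator_of_notMem (fun hmem => ?_) _
    have h' : 0 < 1 - ‖1 - (r : ℂ) * Complex.exp (φ * Complex.I)‖ ^ 2 := hmem
    rw [Complex.one_sub_norm_one_sub_mul_exp_sq] at h'
    linarith
  have hfp {r φ : ℝ} (h : 0 < r * (2 * Real.cos φ - r)) :
      f (r * Complex.exp (φ * Complex.I)) = ENNReal.ofReal ((r * (2 * Real.cos φ - r)) ^ m) *
        F (r * Complex.exp (φ * Complex.I)) := by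
    rw [← Complex.one_sub_norm_one_sub_mul_exp_sq] at h ⊢
    exact Set.indicator_of_mem (show _ ∈ {z : ℂ | 0 < 1 - ‖1 - z‖ ^ 2} from h) _
  -- Directions with `cos φ ≤ 0` point away from the disc and contribute nothing.
  rw [setLIntegral_eq_of_subset_of_eq_zero (s := Set.Ioo (-(Real.pi / 2)) (Real.pi / 2))
    measurableSet_Ioo measurableSet_Ioo (Set.Ioo_subset_Ioo (by linarith) (by linarith))]
  · refine setLIntegral_congr_fun measurableSet_Ioo fun w hw => ?_
    have hc : 0 < 2 * Real.cos w := by linarith [Real.cos_pos_of_mem_Ioo hw]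
    rw [setLIntegral_eq_of_subset_of_eq_zero (s := Set.Ioo 0 (2 * Real.cos w))
      measurableSet_Ioo measurableSet_Ioi Set.Ioo_subset_Ioi_self, lintegral_Ioo_comp_mul_left hc]
    · refine setLIntegral_congr_fun measurableSet_Ioo fun b hb => ?_
      have hb0 := hb.1
      have hb1 : 0 < 1 - b := by linarith [hb.2]
      have hr : 2 * Real.cos w * b * (2 * Real.cos w - 2 * Real.cos w * b)
          = (2 * Real.cos w) ^ 2 * (b * (1 - b)) := by ring
      -- The powers of `2 cos w` add up to `1 + 1 + 2m`: from `dr`, from the polar Jacobian, and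
      -- from the weight. What is left depends on `b` alone.
      have hE : ENNReal.ofReal (2 * Real.cos w) * (ENNReal.ofReal (2 * Real.cos w * b) *
            ENNReal.ofReal (((2 * Real.cos w) ^ 2 * (b * (1 - b))) ^ m))
          = ENNReal.ofReal ((2 * Real.cos w) ^ (2 * m + 2)) *
            ENNReal.ofReal (b ^ (m + 1) * (1 - b) ^ m) := by
        rw [← ENNReal.ofReal_mul (by positivity), ← ENNReal.ofReal_mul hc.le,
          ← ENNReal.ofReal_mul (by positivity)]
        congr 1
        rw [mul_pow, mul_pow b, ← pow_mul]
        ring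
      rw [hfp (by rw [hr]; positivity), hr, ← mul_assoc (ENNReal.ofReal (_ ^ (2 * m + 2))), ← hE,
        mul_comm b (2 * Real.cos w)]
      ring
    · intro r hr
      have hr0 : 0 < r := hr.1
      have hr1 : 2 * Real.cos w ≤ r := not_lt.1 fun h => hr.2 ⟨hr0, h⟩
      rw [hfz (mul_nonpos_of_nonneg_of_nonpos hr0.le (by linarith)), mul_zero]
  · intro φ hφ
    have hcos : Real.cos φ ≤ 0 := by
      rcases le_or_gt φ (-(Real.pi / 2)) with h | h
      · rw [← Real.cos_neg]
        exact Real.cos_nonpos_of_pi_div_two_le_of_le (by linarith) (by linarith [hφ.1.1])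
      · exact Real.cos_nonpos_of_pi_div_two_le_of_le
          (not_lt.1 fun h' => hφ.2 ⟨h, h'⟩) (by linarith [hφ.1.2])
    refine (setLIntegral_congr_fun measurableSet_Ioi (g := fun _ => 0) fun r hr => ?_).trans
      (by simp)
    have hr0 : 0 < r := hr
    simp only
    rw [hfz (mul_nonpos_of_nonneg_of_nonpos hr0.le (by linarith)), mul_zero]

lemma measurable_chord {F : ℂ → ℝ≥0∞} (hF : Measurable F) :
    Measurable fun p : ℝ × ℝ =>
      F ((p.2 * (2 * Real.cos p.1) : ℝ) * Complex.exp (p.1 * Complex.I)) := by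
  fun_prop

lemma lintegral_chord_eq_lintegral_law (m : ℕ) {F : ℂ → ℝ≥0∞} (hF : Measurable F) :
    ∫⁻ w in Set.Ioo (-(Real.pi / 2)) (Real.pi / 2), ∫⁻ b in Set.Ioo (0 : ℝ) 1,
          ENNReal.ofReal ((2 * Real.cos w) ^ (2 * m + 2)) *
            (ENNReal.ofReal (b ^ (m + 1) * (1 - b) ^ m) *
              F ((b * (2 * Real.cos w) : ℝ) * Complex.exp (w * Complex.I)))
      = ENNReal.ofReal (2 ^ (2 * m + 2) / (cosLawConst (m + 1) *
          (1 / ProbabilityTheory.beta ((m + 2 : ℕ) : ℝ) (((m + 2 : ℕ) : ℝ) - 1)))) *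
        ∫⁻ w, (∫⁻ b, F ((b * (2 * Real.cos w) : ℝ) * Complex.exp (w * Complex.I))
          ∂(betaLaw (m + 2))) ∂(cosLaw (m + 2)) := by
  set cb := 1 / ProbabilityTheory.beta ((m + 2 : ℕ) : ℝ) (((m + 2 : ℕ) : ℝ) - 1) with hcb
  have hcb0 : 0 < cb := by
    refine one_div_pos.2 (beta_pos (by positivity) ?_)
    push_cast
    have : (0 : ℝ) ≤ m := by positivity
    linarith
  have hcc0 := cosLawConst_pos (m + 1)
  have hFm := measurable_chord hF
  have hFw (w : ℝ) : Measurable fun b : ℝ =>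
      F ((b * (2 * Real.cos w) : ℝ) * Complex.exp (w * Complex.I)) :=
    hFm.comp measurable_prodMk_left
  have hI : Measurable fun w : ℝ => ∫⁻ b in Set.Ioo (0 : ℝ) 1,
      ENNReal.ofReal (b ^ (m + 1) * (1 - b) ^ m) *
        F ((b * (2 * Real.cos w) : ℝ) * Complex.exp (w * Complex.I)) :=
    Measurable.lintegral_prod_right' (f := fun p : ℝ × ℝ =>
      ENNReal.ofReal (p.2 ^ (m + 1) * (1 - p.2) ^ m) *
        F ((p.2 * (2 * Real.cos p.1) : ℝ) * Complex.exp (p.1 * Complex.I))) (by fun_prop)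
  have hΦ : ∫⁻ w, (∫⁻ b, F ((b * (2 * Real.cos w) : ℝ) * Complex.exp (w * Complex.I))
        ∂(betaLaw (m + 2))) ∂(cosLaw (m + 2))
      = ENNReal.ofReal (cosLawConst (m + 1) * cb) *
        ∫⁻ w in Set.Ioo (-(Real.pi / 2)) (Real.pi / 2),
          ENNReal.ofReal (Real.cos w ^ (2 * (m + 1))) * ∫⁻ b in Set.Ioo (0 : ℝ) 1,
            ENNReal.ofReal (b ^ (m + 1) * (1 - b) ^ m) *
              F ((b * (2 * Real.cos w) : ℝ) * Complex.exp (w * Complex.I)) := by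
    simp only [lintegral_betaLaw m (hFw _), ← hcb]
    rw [lintegral_cosLaw (m + 1) (by fun_prop), ENNReal.ofReal_mul hcc0.le, mul_assoc]
    congr 1
    rw [← lintegral_const_mul _ (by fun_prop)]
    refine lintegral_congr fun w => ?_
    ring
  rw [hΦ, ← mul_assoc, ← ENNReal.ofReal_mul (by positivity), div_mul_cancel₀ _ (by positivity),
    ← lintegral_const_mul _ (by fun_prop)]
  refine setLIntegral_congr_fun measurableSet_Ioo fun w hw => ?_
  have hc := Real.cos_pos_of_mem_Ioo hw
  rw [lintegral_const_mul _ (by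
      exact Measurable.mul (by fun_prop) (hFw w)), mul_pow,
    ENNReal.ofReal_mul (by positivity), mul_assoc]
  rfl

lemma Complex.one_add_exp_two_mul (w : ℝ) :
    1 + Complex.exp ((2 * w : ℝ) * Complex.I)
      = ((1 * (2 * Real.cos w) : ℝ) : ℂ) * Complex.exp (w * Complex.I) := by
  have h1 : ((2 * w : ℝ) : ℂ) * Complex.I = w * Complex.I + w * Complex.I := by push_cast; ring
  have h2 : Complex.exp (-(w : ℂ) * Complex.I) * Complex.exp (w * Complex.I) = 1 := by
    rw [← Complex.exp_add]
    simp
  rw [h1, Complex.exp_add]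
  push_cast
  rw [one_mul, Complex.two_cos, add_mul, h2]
  ring

lemma lintegral_Ioo_eq_lintegral_comp_two_mul (g : ℝ → ℝ≥0∞) :
    ∫⁻ φ in Set.Ioo (-Real.pi) Real.pi, g φ
      = ∫⁻ w in Set.Ioo (-(Real.pi / 2)) (Real.pi / 2), ENNReal.ofReal 2 * g (2 * w) := by
  have himg : (fun b : ℝ => 2 * b) '' Set.Ioo (-(Real.pi / 2)) (Real.pi / 2)
      = Set.Ioo (-Real.pi) Real.pi := by
    rw [Set.image_mul_left_Ioo two_pos]
    congr 1 <;> ring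
  rw [← himg, lintegral_image_eq_lintegral_abs_deriv_mul (f' := fun _ => 2) measurableSet_Ioo
    (fun b _ => by simpa using ((hasDerivAt_id b).const_mul 2).hasDerivWithinAt)
    (fun a _ b _ h => mul_left_cancel₀ two_ne_zero h), abs_of_pos two_pos]

/-- In dimension one the sphere is a circle and there is no density on the disc. After `z ↦ -z` the
quantity is `1 + exp (iφ)` with `φ` uniform, and halving the angle writes it as `2 cos w · exp (iw)`
with `w` uniform, which matches `β = 1`. The radial integral `κ` is never evaluated. -/
lemma exists_lintegral_circle_eq_mul_lintegral_law :
    ∃ C : ℝ≥0∞, ∀ F : ℂ → ℝ≥0∞, Measurable F →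
      ∫⁻ y in {y : Fin 1 → ℂ | sumNormSq y < 1}, F (1 - y 0 / √(sumNormSq y))
        = C * ∫⁻ w, (∫⁻ b, F ((b * (2 * Real.cos w) : ℝ) * Complex.exp (w * Complex.I))
          ∂(betaLaw 1)) ∂(cosLaw 1) := by
  have hm1 : MeasurableSet {z : ℂ | ‖z‖ ^ 2 < 1} :=
    measurableSet_lt (by fun_prop) measurable_const
  let κ : ℝ≥0∞ := ∫⁻ r in Set.Ioi (0 : ℝ), ENNReal.ofReal r * Set.indicator {r : ℝ | r ^ 2 < 1} 1 r
  have hκm : MeasurableSet {r : ℝ | r ^ 2 < 1} := measurableSet_lt (by fun_prop) measurable_const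
  refine ⟨κ * ENNReal.ofReal (2 / cosLawConst 0), fun F hF => ?_⟩
  have hc0 := cosLawConst_pos 0
  rw [lintegral_sumNormSq_lt_one_eq (F := fun z => F (1 - z)) (by fun_prop)]
  have h0 (y : Fin 0 → ℂ) : sumNormSq y = 0 := by simp [sumNormSq]
  simp only [h0, add_zero, lintegral_const]
  have hv : (volume : Measure (Fin 0 → ℂ)) Set.univ = 1 := by
    rw [volume_pi, Measure.pi_univ]
    simp
  let f : ℂ → ℝ≥0∞ := Set.indicator {z : ℂ | ‖z‖ ^ 2 < 1} fun z => F (1 + z / √(‖z‖ ^ 2))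
  have hf : Measurable f := by
    refine Measurable.indicator (hF.comp (measurable_const.add (measurable_id.div ?_))) hm1
    exact Complex.measurable_ofReal.comp (by fun_prop)
  have h1 : ∫⁻ z in {z : ℂ | ‖z‖ ^ 2 < 1}, F (1 - z / √(‖z‖ ^ 2)) = ∫⁻ z, f z := by
    rw [← lintegral_neg_eq_self f, ← lintegral_indicator hm1]
    refine lintegral_congr fun z => ?_
    simp only [f, Set.indicator, Set.mem_ofPred_eq, norm_neg, neg_div, sub_eq_add_neg]
  rw [hv, mul_one, h1, Complex.lintegral_eq_lintegral_polar hf]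
  have h2 : ∀ φ : ℝ, ∫⁻ r in Set.Ioi (0 : ℝ), ENNReal.ofReal r * f (r * Complex.exp (φ * Complex.I))
      = κ * F (1 + Complex.exp (φ * Complex.I)) := by
    intro φ
    have hm : Measurable fun r : ℝ => ENNReal.ofReal r * Set.indicator {r : ℝ | r ^ 2 < 1} 1 r :=
      ENNReal.measurable_ofReal.mul (Measurable.indicator measurable_one hκm)
    simp only [κ]
    rw [← lintegral_mul_const _ hm]
    refine setLIntegral_congr_fun measurableSet_Ioi fun r hr => ?_
    have hr0 : 0 < r := hr
    have hn : ‖(r : ℂ) * Complex.exp (φ * Complex.I)‖ = r := by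
      rw [norm_mul, Complex.norm_exp_ofReal_mul_I, mul_one, Complex.norm_real,
        Real.norm_of_nonneg hr0.le]
    have hd : (r : ℂ) * Complex.exp (φ * Complex.I) / r = Complex.exp (φ * Complex.I) :=
      mul_div_cancel_left₀ _ (by exact_mod_cast hr0.ne')
    simp only [f, Set.indicator, Set.mem_ofPred_eq, hn, Real.sqrt_sq hr0.le, hd, Pi.one_apply]
    split_ifs <;> simp
  simp only [h2]
  rw [lintegral_const_mul _ (by fun_prop), mul_assoc]
  congr 1
  simp only [betaLaw_one]
  have h3 : ∀ w : ℝ, ∫⁻ b, F ((b * (2 * Real.cos w) : ℝ) * Complex.exp (w * Complex.I))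
      ∂(Measure.dirac (1 : ℝ)) = F (1 + Complex.exp ((2 * w : ℝ) * Complex.I)) := by
    intro w
    rw [lintegral_dirac' _ (by fun_prop), Complex.one_add_exp_two_mul]
  simp only [h3]
  rw [lintegral_cosLaw 0 (by fun_prop), ← mul_assoc, ← ENNReal.ofReal_mul (by positivity),
    div_mul_cancel₀ _ hc0.ne', lintegral_Ioo_eq_lintegral_comp_two_mul,
    lintegral_const_mul _ (by fun_prop)]
  simp

/-- Only the independence of `C` from `F` matters: both laws are probability measures, so testing
with `F = 1` identifies `C` with the volume of the ball, and the constants need no comparison. -/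
lemma exists_lintegral_sphere_eq_mul_lintegral_law (n : ℕ) :
    ∃ C : ℝ≥0∞, ∀ F : ℂ → ℝ≥0∞, Measurable F →
      ∫⁻ y in {y : Fin (n + 1) → ℂ | sumNormSq y < 1}, F (1 - y 0 / √(sumNormSq y))
        = C * ∫⁻ w, (∫⁻ b, F ((b * (2 * Real.cos w) : ℝ) * Complex.exp (w * Complex.I))
          ∂(betaLaw (n + 1))) ∂(cosLaw (n + 1)) := by
  cases n with
  | zero => exact exists_lintegral_circle_eq_mul_lintegral_law
  | succ m =>
    refine ⟨(∫⁻ y in {y : Fin (m + 1) → ℂ | sumNormSq y < 1}, ENNReal.ofReal (sumNormSq y)) *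
      ENNReal.ofReal (2 ^ (2 * m + 2) / (cosLawConst (m + 1) *
        (1 / ProbabilityTheory.beta ((m + 2 : ℕ) : ℝ) (((m + 2 : ℕ) : ℝ) - 1)))),
      fun F hF => ?_⟩
    rw [lintegral_sumNormSq_lt_one_eq_disc m (F := fun z => F (1 - z)) (by fun_prop),
      lintegral_disc_eq_lintegral_chord m hF, lintegral_chord_eq_lintegral_law m hF, ← mul_assoc]

/-- If `V` is Haar distributed in the unitary group of size `n + 1`, then `1 - V₀₀` has the law of
`β · 2 cos W · exp (iW)` with `β` and `W` independent of laws `betaLaw (n + 1)` and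
`cosLaw (n + 1)`. -/
theorem lintegral_one_sub_apply_zero_zero {n : ℕ}
    [MeasurableSpace (Matrix.unitaryGroup (Fin (n + 1)) ℂ)]
    [BorelSpace (Matrix.unitaryGroup (Fin (n + 1)) ℂ)]
    (μ : Measure (Matrix.unitaryGroup (Fin (n + 1)) ℂ)) [μ.IsHaarMeasure] [IsProbabilityMeasure μ]
    {F : ℂ → ℝ≥0∞} (hF : Measurable F) :
    ∫⁻ V, F (1 - (V : Matrix (Fin (n + 1)) (Fin (n + 1)) ℂ) 0 0) ∂μ
      = ∫⁻ w, (∫⁻ b, F ((b * (2 * Real.cos w) : ℝ) * Complex.exp (w * Complex.I))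
          ∂(betaLaw (n + 1))) ∂(cosLaw (n + 1)) := by
  obtain ⟨C, hC⟩ := exists_lintegral_sphere_eq_mul_lintegral_law n
  have hkey (F : ℂ → ℝ≥0∞) (hF : Measurable F) :=
    (volume_mul_lintegral_apply_zero_zero μ (F := fun z => F (1 - z)) (by fun_prop)).trans
      (hC F hF)
  have h1 : volume {y : Fin (n + 1) → ℂ | sumNormSq y < 1} = C := by
    simpa using hkey 1 measurable_one
  have h2 := hkey F hF
  rw [← h1] at h2
  exact (ENNReal.mul_right_inj volume_sumNormSq_lt_one_ne_zero
    volume_sumNormSq_lt_one_ne_top).1 h2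

/-! ### Reduction to the unitary group of smaller size -/

lemma ae_cosLaw_mem_Ioo (n : ℕ) :
    ∀ᵐ w ∂(cosLaw (n + 1)), w ∈ Set.Ioo (-(Real.pi / 2)) (Real.pi / 2) := by
  rw [ae_iff]
  change cosLaw (n + 1) (Set.Ioo (-(Real.pi / 2)) (Real.pi / 2))ᶜ = 0
  rw [← lintegral_indicator_one measurableSet_Ioo.compl,
    lintegral_cosLaw n (measurable_one.indicator measurableSet_Ioo.compl)]
  rw [setLIntegral_congr_fun (g := fun _ => 0) measurableSet_Ioo]
  · simp
  · intro w hw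
    simp [hw]

lemma ae_betaLaw_pos (n : ℕ) : ∀ᵐ b ∂(betaLaw (n + 1)), 0 < b := by
  cases n with
  | zero => simp [betaLaw_one]
  | succ m =>
    rw [ae_iff]
    have hm : MeasurableSet {b : ℝ | ¬0 < b} := (measurableSet_lt measurable_const measurable_id).compl
    rw [← lintegral_indicator_one hm, lintegral_betaLaw m (measurable_one.indicator hm)]
    rw [setLIntegral_congr_fun (g := fun _ => 0) measurableSet_Ioo]
    · simp
    · intro b hb
      simp [hb.1]

/-- The embedding of the unitary group of size `n` in the one of size `n + 1`. -/
def Matrix.unitaryGroup.succ {n : ℕ} (U : Matrix.unitaryGroup (Fin n) ℂ) :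
    Matrix.unitaryGroup (Fin (n + 1)) ℂ :=
  ⟨bordered 1 U, (bordered_one_mem_unitaryGroup_iff _).2 U.2⟩

lemma Matrix.unitaryGroup.continuous_succ {n : ℕ} :
    Continuous (Matrix.unitaryGroup.succ (n := n)) := by
  refine Continuous.subtype_mk (continuous_matrix fun i j => ?_) _
  refine Fin.cases ?_ (fun i => ?_) i <;> refine Fin.cases ?_ (fun j => ?_) j
  · simpa using continuous_const
  · simpa using continuous_const
  · simpa using continuous_const
  · exact (continuous_apply_apply i j).comp continuous_subtype_val

/-- Right multiplication by `diag(1, U)` leaves the first column, and hence the reflection, of `V`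
unchanged and only replaces the block `V'` by `V' U`. That `V'` is chosen before `U` is what permits
integrating over `U`. -/
lemma Matrix.exists_mul_succ_eq {n : ℕ} {V : Matrix.unitaryGroup (Fin (n + 1)) ℂ}
    (hV : (V : Matrix (Fin (n + 1)) (Fin (n + 1)) ℂ) 0 0 ≠ 1) :
    ∃ V' : Matrix.unitaryGroup (Fin n) ℂ, ∀ U : Matrix.unitaryGroup (Fin n) ℂ,
      (1 - ((V * unitaryGroup.succ U : Matrix.unitaryGroup (Fin (n + 1)) ℂ) :
        Matrix (Fin (n + 1)) (Fin (n + 1)) ℂ)).det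
        = (1 - (V : Matrix (Fin (n + 1)) (Fin (n + 1)) ℂ) 0 0) *
          (1 - ((V' * U : Matrix.unitaryGroup (Fin n) ℂ) : Matrix (Fin n) (Fin n) ℂ)).det ∧
      ((1 - ((V' * U : Matrix.unitaryGroup (Fin n) ℂ) : Matrix (Fin n) (Fin n) ℂ)).det ≠ 0 →
        ((V * unitaryGroup.succ U : Matrix.unitaryGroup (Fin (n + 1)) ℂ) :
          Matrix (Fin (n + 1)) (Fin (n + 1)) ℂ).logDetOneSub.im
        = (1 - (V : Matrix (Fin (n + 1)) (Fin (n + 1)) ℂ) 0 0).arg +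
          ((V' * U : Matrix.unitaryGroup (Fin n) ℂ) :
            Matrix (Fin n) (Fin n) ℂ).logDetOneSub.im) := by
  obtain ⟨ζ, V', hcond, hdec⟩ := exists_eq_complexReflection_mul_bordered V.2 hV
  refine ⟨V', fun U => ?_⟩
  have hmul : ((V * unitaryGroup.succ U : Matrix.unitaryGroup (Fin (n + 1)) ℂ) :
      Matrix (Fin (n + 1)) (Fin (n + 1)) ℂ)
      = complexReflection (1 - (V : Matrix (Fin (n + 1)) (Fin (n + 1)) ℂ) 0 0) (Fin.cons 1 ζ) *
        bordered 1 ((V' * U : Matrix.unitaryGroup (Fin n) ℂ) : Matrix (Fin n) (Fin n) ℂ) := by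
    have h1 : bordered 1 ((V' * U : Matrix.unitaryGroup (Fin n) ℂ) : Matrix (Fin n) (Fin n) ℂ)
        = bordered 1 (V' : Matrix (Fin n) (Fin n) ℂ) * bordered 1 (U : Matrix (Fin n) (Fin n) ℂ) := by
      rw [bordered_mul, one_mul]
      rfl
    rw [h1, ← mul_assoc, ← hdec]
    rfl
  rw [hmul]
  exact ⟨det_one_sub_complexReflection_mul_bordered _ (by simp) _, fun hd =>
    im_logDetOneSub_complexReflection_mul_bordered (sub_ne_zero.2 hV.symm) hcond (V' * U).2 hd⟩

lemma ae_apply_zero_zero_ne_one {n : ℕ} [MeasurableSpace (Matrix.unitaryGroup (Fin (n + 1)) ℂ)]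
    [BorelSpace (Matrix.unitaryGroup (Fin (n + 1)) ℂ)] (μ : Measure (Matrix.unitaryGroup (Fin (n + 1)) ℂ))
    [μ.IsHaarMeasure] [IsProbabilityMeasure μ] :
    ∀ᵐ V : Matrix.unitaryGroup (Fin (n + 1)) ℂ ∂μ,
      (V : Matrix (Fin (n + 1)) (Fin (n + 1)) ℂ) 0 0 ≠ 1 := by
  have hm : MeasurableSet {V : Matrix.unitaryGroup (Fin (n + 1)) ℂ |
      ¬(V : Matrix (Fin (n + 1)) (Fin (n + 1)) ℂ) 0 0 ≠ 1} := by
    refine (isOpen_ne_fun ?_ continuous_const).measurableSet.compl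
    exact (continuous_apply_apply 0 0).comp continuous_subtype_val
  rw [ae_iff, ← lintegral_indicator_one hm]
  have h0 : Measurable (Set.indicator {(0 : ℂ)} (1 : ℂ → ℝ≥0∞)) :=
    measurable_one.indicator (measurableSet_singleton 0)
  calc _ = ∫⁻ V : Matrix.unitaryGroup (Fin (n + 1)) ℂ, Set.indicator {(0 : ℂ)} 1
          (1 - (V : Matrix (Fin (n + 1)) (Fin (n + 1)) ℂ) 0 0) ∂μ := by
        refine lintegral_congr fun V => ?_
        simp only [Set.indicator, Set.mem_ofPred_eq, Set.mem_singleton_iff, not_not, sub_eq_zero,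
          Pi.one_apply, @eq_comm ℂ 1]
    _ = 0 := by
        rw [lintegral_one_sub_apply_zero_zero μ h0]
        refine (lintegral_congr_ae (g := fun _ => 0) ?_).trans (by simp)
        filter_upwards [ae_cosLaw_mem_Ioo n] with w hw
        refine (lintegral_congr_ae (g := fun _ => 0) ?_).trans (by simp)
        filter_upwards [ae_betaLaw_pos n] with b hb
        have hc := Real.cos_pos_of_mem_Ioo hw
        refine Set.indicator_of_notMem ?_ _
        rw [Set.mem_singleton_iff]
        refine mul_ne_zero ?_ (Complex.exp_ne_zero _)
        exact_mod_cast (by positivity : b * (2 * Real.cos w) ≠ 0)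

/-- Continuity of the branch is available only on the open set of nonzero determinant, whence the
indicator; it is harmless once that set is known to have full measure. -/
lemma Matrix.measurable_indicator_logDetOneSub {N : ℕ}
    [MeasurableSpace (Matrix.unitaryGroup (Fin N) ℂ)] [BorelSpace (Matrix.unitaryGroup (Fin N) ℂ)]
    {G : ℝ × ℝ → ℝ≥0∞} (hG : Measurable G) :
    Measurable (Set.indicator {V : Matrix.unitaryGroup (Fin N) ℂ |
        (1 - (V : Matrix (Fin N) (Fin N) ℂ)).det ≠ 0}
      fun V => G ((V : Matrix (Fin N) (Fin N) ℂ).logDetOneSub.im,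
        ‖(1 - (V : Matrix (Fin N) (Fin N) ℂ)).det‖)) := by
  have hd : Continuous fun V : Matrix.unitaryGroup (Fin N) ℂ =>
      (1 - (V : Matrix (Fin N) (Fin N) ℂ)).det := by fun_prop
  set S := {V : Matrix.unitaryGroup (Fin N) ℂ |
    (1 - (V : Matrix (Fin N) (Fin N) ℂ)).det ≠ 0} with hS
  have hSm : MeasurableSet S := (isOpen_ne_fun hd continuous_const).measurableSet
  have hL : Measurable (Set.indicator S fun V => (V : Matrix (Fin N) (Fin N) ℂ).logDetOneSub.im) := by
    classical
    rw [← Set.piecewise_eq_indicator]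
    exact (Complex.continuous_im.comp_continuousOn continuousOn_logDetOneSub).measurable_piecewise
      continuousOn_const hSm
  have heq : (Set.indicator S fun V => G ((V : Matrix (Fin N) (Fin N) ℂ).logDetOneSub.im,
        ‖(1 - (V : Matrix (Fin N) (Fin N) ℂ)).det‖))
      = Set.indicator S fun V => G (Set.indicator S
          (fun V => (V : Matrix (Fin N) (Fin N) ℂ).logDetOneSub.im) V,
        ‖(1 - (V : Matrix (Fin N) (Fin N) ℂ)).det‖) := by
    funext V
    by_cases hV : V ∈ S
    · rw [Set.indicator_of_mem hV, Set.indicator_of_mem hV, Set.indicator_of_mem hV]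
    · rw [Set.indicator_of_notMem hV, Set.indicator_of_notMem hV]
  rw [heq]
  exact Measurable.indicator (hG.comp (hL.prodMk hd.measurable.norm)) hSm

lemma ae_mul_left_det_one_sub_ne_zero {n : ℕ} [MeasurableSpace (Matrix.unitaryGroup (Fin n) ℂ)]
    [BorelSpace (Matrix.unitaryGroup (Fin n) ℂ)]
    {ν : Measure (Matrix.unitaryGroup (Fin n) ℂ)} [ν.IsMulLeftInvariant]
    (h : ∀ᵐ U : Matrix.unitaryGroup (Fin n) ℂ ∂ν, (1 - (U : Matrix (Fin n) (Fin n) ℂ)).det ≠ 0)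
    (V : Matrix.unitaryGroup (Fin n) ℂ) :
    ∀ᵐ U : Matrix.unitaryGroup (Fin n) ℂ ∂ν,
      (1 - ((V * U : Matrix.unitaryGroup (Fin n) ℂ) : Matrix (Fin n) (Fin n) ℂ)).det ≠ 0 :=
  Measure.QuasiMeasurePreserving.ae (f := (V * ·))
    (p := fun U : Matrix.unitaryGroup (Fin n) ℂ => (1 - (U : Matrix (Fin n) (Fin n) ℂ)).det ≠ 0)
    (measurePreserving_mul_left ν V).quasiMeasurePreserving h

section Recursion

variable {n : ℕ} [MeasurableSpace (Matrix.unitaryGroup (Fin n) ℂ)]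
  [BorelSpace (Matrix.unitaryGroup (Fin n) ℂ)]
  [MeasurableSpace (Matrix.unitaryGroup (Fin (n + 1)) ℂ)]
  [BorelSpace (Matrix.unitaryGroup (Fin (n + 1)) ℂ)]

/-- For each fixed `U`, right invariance of `μ` removes the translation; averaging over `U` then
costs nothing. -/
lemma lintegral_eq_lintegral_lintegral_mul_succ
    (μ : Measure (Matrix.unitaryGroup (Fin (n + 1)) ℂ)) [μ.IsHaarMeasure] [IsProbabilityMeasure μ]
    (ν : Measure (Matrix.unitaryGroup (Fin n) ℂ)) [IsProbabilityMeasure ν]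
    {g : Matrix.unitaryGroup (Fin (n + 1)) ℂ → ℝ≥0∞} (hg : Measurable g) :
    ∫⁻ V, g V ∂μ = ∫⁻ V, (∫⁻ U, g (V * Matrix.unitaryGroup.succ U) ∂ν) ∂μ := by
  have := μ.isMulRightInvariant_of_compactSpace
  have hc : Measurable fun p : Matrix.unitaryGroup (Fin (n + 1)) ℂ ×
      Matrix.unitaryGroup (Fin n) ℂ => p.1 * Matrix.unitaryGroup.succ p.2 :=
    measurable_fst.mul (unitaryGroup.continuous_succ.measurable.comp measurable_snd)
  rw [lintegral_lintegral_swap (f := fun V U => g (V * unitaryGroup.succ U))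
    (hg.comp hc).aemeasurable]
  simp only [lintegral_mul_right_eq_self g]
  simp

lemma ae_det_one_sub_ne_zero_succ
    (μ : Measure (Matrix.unitaryGroup (Fin (n + 1)) ℂ)) [μ.IsHaarMeasure] [IsProbabilityMeasure μ]
    (ν : Measure (Matrix.unitaryGroup (Fin n) ℂ)) [ν.IsMulLeftInvariant] [IsProbabilityMeasure ν]
    (h : ∀ᵐ U : Matrix.unitaryGroup (Fin n) ℂ ∂ν, (1 - (U : Matrix (Fin n) (Fin n) ℂ)).det ≠ 0) :
    ∀ᵐ V : Matrix.unitaryGroup (Fin (n + 1)) ℂ ∂μ,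
      (1 - (V : Matrix (Fin (n + 1)) (Fin (n + 1)) ℂ)).det ≠ 0 := by
  have hd : Continuous fun V : Matrix.unitaryGroup (Fin (n + 1)) ℂ =>
      (1 - (V : Matrix (Fin (n + 1)) (Fin (n + 1)) ℂ)).det := by fun_prop
  set S : Set (Matrix.unitaryGroup (Fin (n + 1)) ℂ) := {V |
    ¬(1 - (V : Matrix (Fin (n + 1)) (Fin (n + 1)) ℂ)).det ≠ 0} with hS
  have hSm : MeasurableSet S := (isOpen_ne_fun hd continuous_const).measurableSet.compl
  rw [ae_iff, ← hS, ← lintegral_indicator_one hSm, lintegral_eq_lintegral_lintegral_mul_succ μ ν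
    (measurable_one.indicator hSm)]
  refine (lintegral_congr_ae (g := fun _ => 0) ?_).trans (by simp)
  filter_upwards [ae_apply_zero_zero_ne_one μ] with V hV
  obtain ⟨V', hV'⟩ := exists_mul_succ_eq hV
  refine (lintegral_congr_ae (g := fun _ => 0) ?_).trans (by simp)
  filter_upwards [ae_mul_left_det_one_sub_ne_zero h V'] with U hU
  refine Set.indicator_of_notMem ?_ _
  rw [hS, Set.mem_ofPred_eq, not_not, (hV' U).1]
  exact mul_ne_zero (sub_ne_zero.2 hV.symm) hU

/-- Integration of a function of `(Im log det (1 - V), |det (1 - V)|)` with respect to Haar measure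
reduces to the unitary group of smaller size. -/
lemma lintegral_logDetOneSub_succ
    (μ : Measure (Matrix.unitaryGroup (Fin (n + 1)) ℂ)) [μ.IsHaarMeasure] [IsProbabilityMeasure μ]
    (ν : Measure (Matrix.unitaryGroup (Fin n) ℂ)) [ν.IsMulLeftInvariant] [IsProbabilityMeasure ν]
    (h : ∀ᵐ U : Matrix.unitaryGroup (Fin n) ℂ ∂ν, (1 - (U : Matrix (Fin n) (Fin n) ℂ)).det ≠ 0)
    {G : ℝ × ℝ → ℝ≥0∞} (hG : Measurable G) :
    ∫⁻ V, G ((V : Matrix (Fin (n + 1)) (Fin (n + 1)) ℂ).logDetOneSub.im,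
        ‖(1 - (V : Matrix (Fin (n + 1)) (Fin (n + 1)) ℂ)).det‖) ∂μ
      = ∫⁻ V, (∫⁻ U, G ((1 - (V : Matrix (Fin (n + 1)) (Fin (n + 1)) ℂ) 0 0).arg +
            (U : Matrix (Fin n) (Fin n) ℂ).logDetOneSub.im,
          ‖1 - (V : Matrix (Fin (n + 1)) (Fin (n + 1)) ℂ) 0 0‖ *
            ‖(1 - (U : Matrix (Fin n) (Fin n) ℂ)).det‖) ∂ν) ∂μ := by
  set S : Set (Matrix.unitaryGroup (Fin (n + 1)) ℂ) := {V |
    (1 - (V : Matrix (Fin (n + 1)) (Fin (n + 1)) ℂ)).det ≠ 0} with hS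
  let g : Matrix.unitaryGroup (Fin (n + 1)) ℂ → ℝ≥0∞ := Set.indicator S
    fun V => G ((V : Matrix (Fin (n + 1)) (Fin (n + 1)) ℂ).logDetOneSub.im,
      ‖(1 - (V : Matrix (Fin (n + 1)) (Fin (n + 1)) ℂ)).det‖)
  have hg : Measurable g := measurable_indicator_logDetOneSub hG
  have hgmem {V : Matrix.unitaryGroup (Fin (n + 1)) ℂ}
      (hV : (1 - (V : Matrix (Fin (n + 1)) (Fin (n + 1)) ℂ)).det ≠ 0) :
      g V = G ((V : Matrix (Fin (n + 1)) (Fin (n + 1)) ℂ).logDetOneSub.im,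
        ‖(1 - (V : Matrix (Fin (n + 1)) (Fin (n + 1)) ℂ)).det‖) :=
    Set.indicator_of_mem (show V ∈ S by rwa [hS, Set.mem_ofPred_eq]) _
  calc _ = ∫⁻ V, g V ∂μ := by
        refine lintegral_congr_ae ?_
        filter_upwards [ae_det_one_sub_ne_zero_succ μ ν h] with V hV
        exact (hgmem hV).symm
    _ = ∫⁻ V, (∫⁻ U, g (V * unitaryGroup.succ U) ∂ν) ∂μ :=
        lintegral_eq_lintegral_lintegral_mul_succ μ ν hg
    _ = _ := by
        refine lintegral_congr_ae ?_
        filter_upwards [ae_apply_zero_zero_ne_one μ] with V hV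
        obtain ⟨V', hV'⟩ := exists_mul_succ_eq hV
        -- For fixed `V` the integrand depends on `U` only through `V' * U`, so left invariance of
        -- `ν` erases `V'`.
        refine Eq.trans (lintegral_congr_ae ?_) (lintegral_mul_left_eq_self _ V')
        filter_upwards [ae_mul_left_det_one_sub_ne_zero h V'] with U hU
        have hne' := mul_ne_zero (sub_ne_zero.2 hV.symm) hU
        rw [← (hV' U).1] at hne'
        rw [hgmem hne', (hV' U).1, (hV' U).2 hU, norm_mul]

end Recursion

/-! ### The joint law by induction on the size -/

/-- The joint law of the independent variables `β` and `W` of index `n + 1`. -/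
noncomputable def betaCosLaw (n : ℕ) : Measure (ℝ × ℝ) :=
  (betaLaw (n + 1)).prod (cosLaw (n + 1))

instance (n : ℕ) : IsProbabilityMeasure (betaCosLaw n) := by
  unfold betaCosLaw; infer_instance

/-- The pair `(∑ wⱼ, ∏ bⱼ · 2 cos wⱼ)` as a function of the pairs `(bⱼ, wⱼ)`. -/
noncomputable def sumProdCos {N : ℕ} (x : Fin N → ℝ × ℝ) : ℝ × ℝ :=
  (∑ j, (x j).2, ∏ j, (x j).1 * (2 * Real.cos (x j).2))

@[fun_prop]
lemma measurable_sumProdCos {N : ℕ} : Measurable (sumProdCos (N := N)) := by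
  unfold sumProdCos; fun_prop

/-- The last coordinate is split off, so that the remaining ones keep their indices and laws. -/
lemma lintegral_pi_betaCosLaw_succ {n : ℕ} {G : ℝ × ℝ → ℝ≥0∞} (hG : Measurable G) :
    ∫⁻ x, G (sumProdCos x) ∂(Measure.pi fun j : Fin (n + 1) => betaCosLaw j)
      = ∫⁻ w, (∫⁻ b, (∫⁻ x, G (w + (sumProdCos x).1, b * (2 * Real.cos w) * (sumProdCos x).2)
          ∂(Measure.pi fun j : Fin n => betaCosLaw j)) ∂(betaLaw (n + 1))) ∂(cosLaw (n + 1)) := by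
  have hmp := measurePreserving_piFinSuccAbove (fun j : Fin (n + 1) => betaCosLaw j) (Fin.last n)
  simp only [Fin.val_last, Fin.succAbove_last, Fin.val_castSucc] at hmp
  let H : (ℝ × ℝ) × (Fin n → ℝ × ℝ) → ℝ≥0∞ := fun p =>
    G (p.1.2 + (sumProdCos p.2).1, p.1.1 * (2 * Real.cos p.1.2) * (sumProdCos p.2).2)
  have hH : Measurable H := by fun_prop
  have h1 : ∀ x : Fin (n + 1) → ℝ × ℝ, G (sumProdCos x)
      = H (MeasurableEquiv.piFinSuccAbove (fun _ => ℝ × ℝ) (Fin.last n) x) := by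
    intro x
    simp only [H, sumProdCos, Fin.sum_univ_castSucc, Fin.prod_univ_castSucc]
    simp [MeasurableEquiv.piFinSuccAbove, Fin.insertNthEquiv, Fin.init, add_comm, mul_comm]
  simp only [h1]
  rw [hmp.lintegral_comp hH, lintegral_prod _ hH.aemeasurable]
  have h2 : Measurable fun q : ℝ × ℝ => ∫⁻ x, H (q, x) ∂(Measure.pi fun j : Fin n => betaCosLaw j) :=
    hH.lintegral_prod_right'
  rw [betaCosLaw, lintegral_prod_symm _ h2.aemeasurable]

lemma measurable_lintegral_arg_add {n : ℕ} {G : ℝ × ℝ → ℝ≥0∞} (hG : Measurable G) :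
    Measurable fun κ : ℂ => ∫⁻ x, G (κ.arg + (sumProdCos x).1, ‖κ‖ * (sumProdCos x).2)
      ∂(Measure.pi fun j : Fin n => betaCosLaw j) :=
  Measurable.lintegral_prod_right' (f := fun p : ℂ × (Fin n → ℝ × ℝ) =>
    G (p.1.arg + (sumProdCos p.2).1, ‖p.1‖ * (sumProdCos p.2).2)) (by fun_prop)

/-- For `V` Haar distributed in the unitary group, `det (1 - V)` does not vanish almost surely, and
the joint law of `Im log det (1 - V)` and `|det (1 - V)|` is the law of
`(∑ Wⱼ, ∏ βⱼ · 2 cos Wⱼ)`. -/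
theorem Matrix.unitaryGroup.law_logDetOneSub (N : ℕ) :
    ∀ [MeasurableSpace (Matrix.unitaryGroup (Fin N) ℂ)] [BorelSpace (Matrix.unitaryGroup (Fin N) ℂ)]
    (μ : Measure (Matrix.unitaryGroup (Fin N) ℂ)) [μ.IsHaarMeasure] [IsProbabilityMeasure μ],
    (∀ᵐ V : Matrix.unitaryGroup (Fin N) ℂ ∂μ, (1 - (V : Matrix (Fin N) (Fin N) ℂ)).det ≠ 0) ∧
    ∀ G : ℝ × ℝ → ℝ≥0∞, Measurable G →
      ∫⁻ V, G ((V : Matrix (Fin N) (Fin N) ℂ).logDetOneSub.im,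
          ‖(1 - (V : Matrix (Fin N) (Fin N) ℂ)).det‖) ∂μ
        = ∫⁻ x, G (sumProdCos x) ∂(Measure.pi fun j : Fin N => betaCosLaw j) := by
  induction N with
  | zero =>
    intro _ _ μ _ _
    refine ⟨ae_of_all _ fun V => by simp, fun G hG => ?_⟩
    simp [Matrix.logDetOneSub, Matrix.charpoly, sumProdCos]
  | succ n ih =>
    intro _ _ μ _ _
    let _ : MeasurableSpace (Matrix.unitaryGroup (Fin n) ℂ) := borel _
    have : BorelSpace (Matrix.unitaryGroup (Fin n) ℂ) := ⟨rfl⟩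
    let ν : Measure (Matrix.unitaryGroup (Fin n) ℂ) := Measure.haarMeasure ⊤
    have : IsProbabilityMeasure ν := ⟨Measure.haarMeasure_self⟩
    obtain ⟨ih0, ihG⟩ := ih ν
    refine ⟨ae_det_one_sub_ne_zero_succ μ ν ih0, fun G hG => ?_⟩
    -- `K` is the induction hypothesis integrated out: a function of `κ = 1 - V₀₀` alone, to which
    -- the law of that entry applies.
    let K : ℂ → ℝ≥0∞ := fun κ => ∫⁻ x, G (κ.arg + (sumProdCos x).1, ‖κ‖ * (sumProdCos x).2)
      ∂(Measure.pi fun j : Fin n => betaCosLaw j)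
    have hK : Measurable K := measurable_lintegral_arg_add hG
    rw [lintegral_logDetOneSub_succ μ ν ih0 hG]
    calc _ = ∫⁻ V, K (1 - (V : Matrix (Fin (n + 1)) (Fin (n + 1)) ℂ) 0 0) ∂μ :=
          lintegral_congr fun V => ihG (fun p =>
            G ((1 - (V : Matrix (Fin (n + 1)) (Fin (n + 1)) ℂ) 0 0).arg + p.1,
              ‖1 - (V : Matrix (Fin (n + 1)) (Fin (n + 1)) ℂ) 0 0‖ * p.2)) (by fun_prop)
      _ = ∫⁻ w, (∫⁻ b, K ((b * (2 * Real.cos w) : ℝ) * Complex.exp (w * Complex.I))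
            ∂(betaLaw (n + 1))) ∂(cosLaw (n + 1)) := lintegral_one_sub_apply_zero_zero μ hK
      _ = _ := by
          rw [lintegral_pi_betaCosLaw_succ hG]
          refine lintegral_congr_ae ?_
          filter_upwards [ae_cosLaw_mem_Ioo n] with w hw
          refine lintegral_congr_ae ?_
          filter_upwards [ae_betaLaw_pos n] with b hb
          have hc := Real.cos_pos_of_mem_Ioo hw
          have hr : 0 < b * (2 * Real.cos w) := by positivity
          have hpi := Real.pi_pos
          -- Almost surely the modulus is positive and `w` lies within `(-π, π]`, so the principal
          -- argument recovers `w` exactly.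
          have harg : (((b * (2 * Real.cos w) : ℝ) : ℂ) * Complex.exp (w * Complex.I)).arg = w := by
            rw [Complex.exp_mul_I]
            exact Complex.arg_mul_cos_add_sin_mul_I hr ⟨by linarith [hw.1], by linarith [hw.2]⟩
          have hnorm : ‖((b * (2 * Real.cos w) : ℝ) : ℂ) * Complex.exp (w * Complex.I)‖
              = b * (2 * Real.cos w) := by
            rw [norm_mul, Complex.norm_exp_ofReal_mul_I, mul_one, Complex.norm_real,
              Real.norm_of_nonneg hr.le]
          simp only [K, harg, hnorm]

/-! ### From mutual independence to independent pairs -/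

/-- The inverse regrouping `e'` pulls boxes back to products of rectangles, which identifies the two
product measures; mapping back is then the identity. -/
lemma MeasureTheory.Measure.map_pi_sumElim {ι : Type*} [Fintype ι] (a b : ι → Measure ℝ)
    [∀ i, IsProbabilityMeasure (a i)] [∀ i, IsProbabilityMeasure (b i)] :
    (Measure.pi (Sum.elim a b)).map (fun y i => (y (Sum.inl i), y (Sum.inr i)))
      = Measure.pi fun i => (a i).prod (b i) := by
  have hab : ∀ k, IsProbabilityMeasure (Sum.elim a b k) := by
    rintro (i | i) <;> (simp only [Sum.elim_inl, Sum.elim_inr]; infer_instance)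
  let e' : (ι → ℝ × ℝ) → (ι ⊕ ι → ℝ) := fun x =>
    Sum.elim (fun i => (x i).1) (fun i => (x i).2)
  have he' : Measurable e' := by
    refine measurable_pi_iff.2 ?_
    rintro (i | i)
    · exact measurable_fst.comp (measurable_pi_apply i)
    · exact measurable_snd.comp (measurable_pi_apply i)
  have h : (Measure.pi fun i => (a i).prod (b i)).map e' = Measure.pi (Sum.elim a b) := by
    refine (Measure.pi_eq fun s hs => ?_).symm
    have hpre : e' ⁻¹' (Set.univ.pi s)
        = Set.univ.pi fun i => s (Sum.inl i) ×ˢ s (Sum.inr i) := by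
      ext x
      simp [e', Set.mem_pi, forall_and]
    rw [Measure.map_apply he' (MeasurableSet.univ_pi hs), hpre, Measure.pi_pi,
      Fintype.prod_sum_type, ← Finset.prod_mul_distrib]
    exact Finset.prod_congr rfl fun i _ => Measure.prod_prod _ _
  rw [← h, Measure.map_map (by fun_prop) he']
  exact Measure.map_id

section Pairs

variable {N : ℕ} {Ω : Type*} [MeasurableSpace Ω] {P : Measure Ω}
  {β W : Fin N → Ω → ℝ}

lemma map_pairs_eq_pi_betaCosLaw [IsProbabilityMeasure P]
    (hβ : ∀ j : Fin N, HasLaw (β j) (betaLaw ((j : ℕ) + 1)) P)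
    (hW : ∀ j : Fin N, HasLaw (W j) (cosLaw ((j : ℕ) + 1)) P)
    (hindep : iIndepFun (Sum.elim β W) P) :
    P.map (fun ω j => (β j ω, W j ω)) = Measure.pi fun j : Fin N => betaCosLaw j := by
  have hm : ∀ k, AEMeasurable (Sum.elim β W k) P := by
    rintro (i | i)
    exacts [(hβ i).aemeasurable, (hW i).aemeasurable]
  have h := (iIndepFun_iff_map_fun_eq_pi_map hm).1 hindep
  have hlaw : (fun k => P.map (Sum.elim β W k))
      = Sum.elim (fun j : Fin N => betaLaw ((j : ℕ) + 1)) (fun j : Fin N => cosLaw ((j : ℕ) + 1)) := by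
    funext k
    rcases k with i | i
    exacts [(hβ i).map_eq, (hW i).map_eq]
  rw [hlaw] at h
  have h2 := Measure.map_pi_sumElim (fun j : Fin N => betaLaw ((j : ℕ) + 1))
    (fun j : Fin N => cosLaw ((j : ℕ) + 1))
  rw [← h, AEMeasurable.map_map_of_aemeasurable (by fun_prop) (aemeasurable_pi_lambda _ hm)] at h2
  exact h2

lemma aemeasurable_pairs (hβ : ∀ j : Fin N, HasLaw (β j) (betaLaw ((j : ℕ) + 1)) P)
    (hW : ∀ j : Fin N, HasLaw (W j) (cosLaw ((j : ℕ) + 1)) P) (j : Fin N) :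
    AEMeasurable (fun ω => (β j ω, W j ω)) P :=
  (hβ j).aemeasurable.prodMk (hW j).aemeasurable

/-- The joint law of the pairs is a product measure, and its marginals are the laws of the
individual pairs. -/
lemma iIndepFun_pairs [IsProbabilityMeasure P]
    (hβ : ∀ j : Fin N, HasLaw (β j) (betaLaw ((j : ℕ) + 1)) P)
    (hW : ∀ j : Fin N, HasLaw (W j) (cosLaw ((j : ℕ) + 1)) P)
    (hindep : iIndepFun (Sum.elim β W) P) :
    iIndepFun (fun j ω => (β j ω, W j ω)) P := by
  have hm := aemeasurable_pairs hβ hW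
  have h := map_pairs_eq_pi_betaCosLaw hβ hW hindep
  rw [iIndepFun_iff_map_fun_eq_pi_map hm, h]
  congr 1
  funext j
  have h2 := congrArg (Measure.map (Function.eval j)) h
  rw [AEMeasurable.map_map_of_aemeasurable (measurable_pi_apply j).aemeasurable
    (aemeasurable_pi_lambda _ hm),
    (measurePreserving_eval (fun j : Fin N => betaCosLaw j) j).map_eq] at h2
  exact h2.symm

lemma ProbabilityTheory.HasLaw.ae_of_ae {X : Ω → ℝ} {μ : Measure ℝ} (hX : HasLaw X μ P) {p : ℝ → Prop}
    (hp : ∀ᵐ x ∂μ, p x) : ∀ᵐ ω ∂P, p (X ω) :=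
  ae_of_ae_map hX.aemeasurable (hX.map_eq ▸ hp)

lemma ae_beta_mul_two_cos_ne_zero
    (hβ : ∀ j : Fin N, HasLaw (β j) (betaLaw ((j : ℕ) + 1)) P)
    (hW : ∀ j : Fin N, HasLaw (W j) (cosLaw ((j : ℕ) + 1)) P) :
    ∀ᵐ ω ∂P, ∀ j, β j ω * (2 * Real.cos (W j ω)) ≠ 0 := by
  refine ae_all_iff.2 fun j => ?_
  filter_upwards [(hβ j).ae_of_ae (ae_betaLaw_pos j),
    (hW j).ae_of_ae (ae_cosLaw_mem_Ioo j)] with ω hb hw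
  have := Real.cos_pos_of_mem_Ioo hw
  positivity

end Pairs

/-! ### Rotation by `θ` and the conclusion -/

/-- Multiplication of a unitary matrix by `exp (-iθ)`. -/
noncomputable def Matrix.unitaryGroup.rotate {N : ℕ} (θ : ℝ) (V : Matrix.unitaryGroup (Fin N) ℂ) :
    Matrix.unitaryGroup (Fin N) ℂ :=
  ⟨Complex.exp (-(θ * Complex.I)) • (1 : Matrix (Fin N) (Fin N) ℂ), by
    rw [mem_unitaryGroup_iff, star_smul, star_one, smul_mul_smul_comm, mul_one, Complex.star_def,
      Complex.mul_conj']
    have : ‖Complex.exp (-(θ * Complex.I))‖ = 1 := by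
      rw [← neg_mul, ← Complex.ofReal_neg, Complex.norm_exp_ofReal_mul_I]
    simp [this]⟩ * V

lemma Matrix.unitaryGroup.coe_rotate {N : ℕ} (θ : ℝ) (V : Matrix.unitaryGroup (Fin N) ℂ) :
    (rotate θ V : Matrix (Fin N) (Fin N) ℂ)
      = Complex.exp (-(θ * Complex.I)) • (V : Matrix (Fin N) (Fin N) ℂ) := by
  simp [rotate]

section Unitary

variable {N : ℕ} [MeasurableSpace (Matrix.unitaryGroup (Fin N) ℂ)]
  [BorelSpace (Matrix.unitaryGroup (Fin N) ℂ)]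
  (μ : Measure (Matrix.unitaryGroup (Fin N) ℂ)) [μ.IsHaarMeasure]

lemma aemeasurable_logDetOneSub [IsProbabilityMeasure μ] :
    AEMeasurable (fun V : Matrix.unitaryGroup (Fin N) ℂ =>
      (V : Matrix (Fin N) (Fin N) ℂ).logDetOneSub) μ := by
  have hd : Continuous fun V : Matrix.unitaryGroup (Fin N) ℂ =>
      (1 - (V : Matrix (Fin N) (Fin N) ℂ)).det := by fun_prop
  have hSm : MeasurableSet {V : Matrix.unitaryGroup (Fin N) ℂ |
      (1 - (V : Matrix (Fin N) (Fin N) ℂ)).det ≠ 0} :=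
    (isOpen_ne_fun hd continuous_const).measurableSet
  have h := continuousOn_logDetOneSub.aemeasurable (μ := μ) hSm
  rwa [Measure.restrict_eq_self_of_ae_mem] at h
  exact (unitaryGroup.law_logDetOneSub N μ).1

lemma aemeasurable_im_logDetOneSub_norm_det [IsProbabilityMeasure μ] :
    AEMeasurable (fun V : Matrix.unitaryGroup (Fin N) ℂ =>
      ((V : Matrix (Fin N) (Fin N) ℂ).logDetOneSub.im,
        ‖(1 - (V : Matrix (Fin N) (Fin N) ℂ)).det‖)) μ := by
  have hd : Continuous fun V : Matrix.unitaryGroup (Fin N) ℂ =>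
      (1 - (V : Matrix (Fin N) (Fin N) ℂ)).det := by fun_prop
  exact (Complex.measurable_im.comp_aemeasurable (aemeasurable_logDetOneSub μ)).prodMk
    hd.measurable.norm.aemeasurable

lemma map_logDetOneSub [IsProbabilityMeasure μ] :
    μ.map (fun V : Matrix.unitaryGroup (Fin N) ℂ => ((V : Matrix (Fin N) (Fin N) ℂ).logDetOneSub.im,
        ‖(1 - (V : Matrix (Fin N) (Fin N) ℂ)).det‖))
      = (Measure.pi fun j : Fin N => betaCosLaw j).map sumProdCos := by
  have hm := aemeasurable_im_logDetOneSub_norm_det μ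
  refine Measure.ext_of_lintegral _ fun G hG => ?_
  rw [lintegral_map' hG.aemeasurable hm, lintegral_map hG measurable_sumProdCos]
  exact (unitaryGroup.law_logDetOneSub N μ).2 G hG

lemma Matrix.unitaryGroup.measurePreserving_rotate (θ : ℝ) :
    MeasurePreserving (rotate (N := N) θ) μ μ :=
  measurePreserving_mul_left μ _

end Unitary

theorem theorem3p2 (N : ℕ) (θ : ℝ)
    [MeasurableSpace (Matrix.unitaryGroup (Fin N) ℂ)] [BorelSpace (Matrix.unitaryGroup (Fin N) ℂ)]
    (μ : Measure (Matrix.unitaryGroup (Fin N) ℂ)) [μ.IsHaarMeasure] [IsProbabilityMeasure μ]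
    {Ω₁ : Type*} [MeasurableSpace Ω₁] (P₁ : Measure Ω₁) [IsProbabilityMeasure P₁]
    (V : Ω₁ → Matrix.unitaryGroup (Fin N) ℂ) (hV : HasLaw V μ P₁)
    {Ω₂ : Type*} [MeasurableSpace Ω₂] (P₂ : Measure Ω₂) [IsProbabilityMeasure P₂]
    (β W : Fin N → Ω₂ → ℝ)
    (hβ : ∀ j : Fin N, HasLaw (β j) (betaLaw ((j : ℕ) + 1)) P₂)
    (hW : ∀ j : Fin N, HasLaw (W j) (cosLaw ((j : ℕ) + 1)) P₂)
    (hindep : iIndepFun (Sum.elim β W) P₂) :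
    IdentDistrib
        (fun ω => ((logZ (V ω) θ).im, ‖charPolyZ (V ω) θ‖))
        (fun ω => (∑ j, W j ω, ∏ j, β j ω * (2 * Real.cos (W j ω)))) P₁ P₂ ∧
    (iIndepFun (fun j ω => Real.log (β j ω * (2 * Real.cos (W j ω)))) P₂ ∧
      IdentDistrib (fun ω => (logZ (V ω) θ).re)
        (fun ω => ∑ j, Real.log (β j ω * (2 * Real.cos (W j ω)))) P₁ P₂) ∧
    (iIndepFun W P₂ ∧
      IdentDistrib (fun ω => (logZ (V ω) θ).im) (fun ω => ∑ j, W j ω) P₁ P₂) := by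
  have hX : HasLaw (fun ω => unitaryGroup.rotate θ (V ω)) μ P₁ := by
    have h := unitaryGroup.measurePreserving_rotate μ θ
    refine ⟨h.measurable.comp_aemeasurable hV.aemeasurable, ?_⟩
    have h2 := AEMeasurable.map_map_of_aemeasurable (μ := P₁)
      (h.measurable.aemeasurable) hV.aemeasurable
    rw [hV.map_eq, h.map_eq] at h2
    exact h2.symm
  have hlog (ω : Ω₁) : logZ (V ω) θ
      = (unitaryGroup.rotate θ (V ω) : Matrix (Fin N) (Fin N) ℂ).logDetOneSub := by
    rw [logZ_eq_logDetOneSub, unitaryGroup.coe_rotate]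
  have hdet (ω : Ω₁) : charPolyZ (V ω) θ
      = (1 - (unitaryGroup.rotate θ (V ω) : Matrix (Fin N) (Fin N) ℂ)).det := by
    rw [charPolyZ, unitaryGroup.coe_rotate]
  have hfm := aemeasurable_im_logDetOneSub_norm_det μ
  rw [← hX.map_eq] at hfm
  have hpm := aemeasurable_pi_lambda _ (aemeasurable_pairs hβ hW)
  have hmain : IdentDistrib
      (fun ω => ((logZ (V ω) θ).im, ‖charPolyZ (V ω) θ‖))
      (fun ω => (∑ j, W j ω, ∏ j, β j ω * (2 * Real.cos (W j ω)))) P₁ P₂ := by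
    simp only [hlog, hdet]
    refine ⟨hfm.comp_aemeasurable hX.aemeasurable,
      measurable_sumProdCos.comp_aemeasurable hpm, ?_⟩
    have h1 := AEMeasurable.map_map_of_aemeasurable (μ := P₁) hfm hX.aemeasurable
    have h2 := AEMeasurable.map_map_of_aemeasurable (μ := P₂)
      measurable_sumProdCos.aemeasurable hpm
    rw [hX.map_eq, map_logDetOneSub] at h1
    rw [map_pairs_eq_pi_betaCosLaw hβ hW hindep] at h2
    exact h1.symm.trans h2
  have hpairs := iIndepFun_pairs hβ hW hindep
  refine ⟨hmain, ⟨?_, ?_⟩, ?_, hmain.comp measurable_fst⟩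
  · exact hpairs.comp (fun _ p => Real.log (p.1 * (2 * Real.cos p.2))) fun _ => by fun_prop
  · have hre : (fun ω => Real.log ‖charPolyZ (V ω) θ‖) =ᵐ[P₁] fun ω => (logZ (V ω) θ).re := by
      have hne : ∀ᵐ ω ∂P₁, (1 - (unitaryGroup.rotate θ (V ω) : Matrix (Fin N) (Fin N) ℂ)).det ≠ 0 :=
        ae_of_ae_map hX.aemeasurable
          (p := fun V : Matrix.unitaryGroup (Fin N) ℂ =>
            (1 - (V : Matrix (Fin N) (Fin N) ℂ)).det ≠ 0)
          (by rw [hX.map_eq]; exact (unitaryGroup.law_logDetOneSub N μ).1)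
      filter_upwards [hne] with ω hω
      rw [hdet, hlog, ← exp_logDetOneSub hω, Complex.norm_exp, Real.log_exp]
    -- The logarithm of the product splits only if no factor vanishes, which holds almost surely.
    have hlogprod : (fun ω => Real.log (∏ j, β j ω * (2 * Real.cos (W j ω)))) =ᵐ[P₂]
        fun ω => ∑ j, Real.log (β j ω * (2 * Real.cos (W j ω))) := by
      filter_upwards [ae_beta_mul_two_cos_ne_zero hβ hW] with ω hω
      exact Real.log_prod fun j _ => hω j
    have hcomp : IdentDistrib (fun ω => Real.log ‖charPolyZ (V ω) θ‖)
        (fun ω => Real.log (∏ j, β j ω * (2 * Real.cos (W j ω)))) P₁ P₂ :=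
      hmain.comp (Real.measurable_log.comp measurable_snd)
    exact ⟨hcomp.aemeasurable_fst.congr hre, hcomp.aemeasurable_snd.congr hlogprod,
      by rw [← Measure.map_congr hre, ← Measure.map_congr hlogprod, hcomp.map_eq]⟩
  · exact hpairs.comp (fun _ p => p.2) fun _ => measurable_snd
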